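/- Let $f:\mathbb{R}\to\mathbb{C}$ be a Lebesgue measurable function with $$\int_{\mathbb{R}} \frac{|f(x)|}{(1+|x|)^n}\,dx<\infty$$ for some real $n>0$. View $f$ as the tempered distribution $\varphi\mapsto\int_{\mathbb R} f\varphi\,dx$, and let $\widehat f$ be its distributional Fourier transform, $\langle \widehat f,\varphi\rangle=\langle f,\widehat\varphi\rangle$ for Schwartz functions $\varphi$, where $\widehat{\varphi}(\zeta)=\frac{1}{\sqrt{2\pi}}\int_{\mathbb R}\varphi(x)e^{-ix\zeta}\,dx$. Suppose that for some $A\in\mathbb{R}$ the distribution $\widehat f$ is an integrable function on $[A,\infty)$: there is a function $g$, integrable on $[A,\infty)$, such that $\langle\widehat f,\varphi\rangle=\int_A^\infty g\varphi\,d\zeta$ for every smooth $\varphi$ with compact support contained in $(A,\infty)$. Suppose also that, for some constant $c>0$, $$\int_\zeta^\infty |g(t)|\,dt=\mathcal{O}\big(e^{-c\sqrt{\zeta}}\big)\quad\text{as }\zeta\to+\infty .$$ Then there exists an open set $U\subset\mathbb{R}$ such that $f=0$ almost everywhere outside of $U$, and every $x\in U$ lies in a bounded open interval $I$ on which $\log|f|$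 (with $\log 0=-\infty$) is integrable with respect to Lebesgue measure; equivalently, $\int_I\log|f(t)|\,dt>-\infty$. -/

import Mathlib

open MeasureTheory Set Filter Topology Asymptotics
open scoped SchwartzMap FourierTransform

noncomputable section

namespace Clumping

/-- The growth condition `∫ |f(x)| / (1 + |x|) ^ n dx < ∞` for a (Lebesgue) measurable `f`. -/
structure TemperedGrowth (f : ℝ → ℂ) (n : ℝ) : Prop where
  aestronglyMeasurable : AEStronglyMeasurable f volume
  integrable : Integrable (fun x : ℝ => ‖f x‖ / (1 + |x|) ^ n) volume

/-- The integral of a Schwartz function against `f` is dominated by a Schwartz seminorm. -/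
theorem TemperedGrowth.exists_bound {f : ℝ → ℂ} {n : ℝ} (hf : TemperedGrowth f n) :
    ∃ (s : Finset (ℕ × ℕ)) (C : ℝ), 0 ≤ C ∧ ∀ φ : 𝓢(ℝ, ℂ),
      (Integrable (fun x : ℝ => φ x * f x) volume) ∧
      ‖∫ x : ℝ, φ x * f x‖ ≤ C * s.sup (schwartzSeminormFamily ℂ ℝ ℂ) φ := by
  obtain ⟨N, hN⟩ := exists_nat_ge n
  refine ⟨Finset.Iic (N, 0), 2 ^ N * ∫ x : ℝ, ‖f x‖ / (1 + |x|) ^ n, ?_, fun φ => ?_⟩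
  · positivity
  · set S := (Finset.Iic (N, 0)).sup (schwartzSeminormFamily ℂ ℝ ℂ) φ with hS
    have hb (x : ℝ) : ‖φ x * f x‖ ≤ (2 ^ N * S) * (‖f x‖ / (1 + |x|) ^ n) := by
      have h := SchwartzMap.one_add_le_sup_seminorm_apply (𝕜 := ℂ) (m := (N, 0)) (k := N) (n := 0)
        le_rfl le_rfl φ x
      rw [norm_iteratedFDeriv_zero] at h
      have h1 : (1 : ℝ) ≤ 1 + |x| := by linarith [abs_nonneg x]
      have h2 : (0 : ℝ) < (1 + |x|) ^ n := Real.rpow_pos_of_pos (by linarith) n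
      have h3 : (1 + |x|) ^ n ≤ (1 + ‖x‖) ^ N := by
        rw [Real.norm_eq_abs, ← Real.rpow_natCast]
        exact Real.rpow_le_rpow_of_exponent_le h1 hN
      have h4 : (1 + |x|) ^ n * ‖φ x‖ ≤ 2 ^ N * S :=
        (mul_le_mul_of_nonneg_right h3 (norm_nonneg _)).trans h
      rw [norm_mul, ← mul_div_assoc, le_div_iff₀ h2]
      nlinarith [mul_le_mul_of_nonneg_right h4 (norm_nonneg (f x))]
    have hi : Integrable (fun x : ℝ => φ x * f x) volume :=
      (hf.integrable.const_mul (2 ^ N * S)).mono'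
        (φ.continuous.aestronglyMeasurable.mul hf.aestronglyMeasurable) (Eventually.of_forall hb)
    refine ⟨hi, ?_⟩
    calc ‖∫ x : ℝ, φ x * f x‖ ≤ ∫ x : ℝ, (2 ^ N * S) * (‖f x‖ / (1 + |x|) ^ n) :=
          norm_integral_le_of_norm_le (hf.integrable.const_mul _) (Eventually.of_forall hb)
      _ = _ := by rw [integral_const_mul]; ring

/-- The tempered distribution `φ ↦ ∫ φ(x) f(x) dx` defined by a measurable function `f` with
`∫ |f(x)| / (1 + |x|) ^ n dx < ∞`. -/
def TemperedGrowth.toTemperedDistribution {f : ℝ → ℂ} {n : ℝ} (hf : TemperedGrowth f n) :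
    𝓢'(ℝ, ℂ) :=
  ContinuousLinearMap.toPointwiseConvergenceCLM _ _ _ _ <|
    SchwartzMap.mkCLMtoNormedSpace (𝕜 := ℂ) (σ := RingHom.id ℂ)
      (fun φ : 𝓢(ℝ, ℂ) => ∫ x : ℝ, φ x * f x)
      (fun φ ψ => by
        obtain ⟨s, C, -, h⟩ := hf.exists_bound
        simp only [add_apply, add_mul]
        exact integral_add (h φ).1 (h ψ).1)
      (fun a φ => by
        simp only [smul_apply, smul_eq_mul, mul_assoc, RingHom.id_apply]
        exact integral_const_mul _ _)
      (by
        obtain ⟨s, C, hC, h⟩ := hf.exists_bound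
        exact ⟨s, C, hC, fun φ => (h φ).2⟩)

theorem TemperedGrowth.toTemperedDistribution_apply {f : ℝ → ℂ} {n : ℝ}
    (hf : TemperedGrowth f n) (φ : 𝓢(ℝ, ℂ)) :
    hf.toTemperedDistribution φ = ∫ x : ℝ, φ x * f x := rfl

/-- The Fourier transform `φ ↦ (2π)^(-1/2) ∫ φ(x) e^{-ixζ} dx` on Schwartz functions, obtained by
rescaling Mathlib's transform `∫ φ(x) e^{-2πixζ} dx`; see `schwartzFourier_apply`. -/
def schwartzFourier : 𝓢(ℝ, ℂ) →L[ℂ] 𝓢(ℝ, ℂ) :=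
  ((1 / Real.sqrt (2 * Real.pi) : ℝ) : ℂ) •
    ((SchwartzMap.compCLMOfContinuousLinearEquiv ℂ
      (ContinuousLinearEquiv.smulLeft
        (Units.mk0 (2 * Real.pi)⁻¹ (inv_ne_zero Real.two_pi_pos.ne') : ℝˣ) : ℝ ≃L[ℝ] ℝ)).comp
      (FourierTransform.fourierCLM ℂ 𝓢(ℝ, ℂ)))

theorem schwartzFourier_apply (φ : 𝓢(ℝ, ℂ)) (ζ : ℝ) :
    schwartzFourier φ ζ = ((1 / Real.sqrt (2 * Real.pi) : ℝ) : ℂ) *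
      ∫ x : ℝ, φ x * Complex.exp (-Complex.I * x * ζ) := by
  have h : schwartzFourier φ ζ = ((1 / Real.sqrt (2 * Real.pi) : ℝ) : ℂ) *
      (𝓕 (φ : ℝ → ℂ)) ((2 * Real.pi)⁻¹ * ζ) := rfl
  rw [h, Real.fourier_real_eq_integral_exp_smul]
  congr 1
  refine integral_congr_ae (Eventually.of_forall fun x => ?_)
  have hp : (Real.pi : ℂ) ≠ 0 := by exact_mod_cast Real.pi_ne_zero
  simp only [smul_eq_mul]
  rw [mul_comm]
  congr 2
  push_cast
  field_simp

/-- The distributional Fourier transform, `⟨û, φ⟩ = ⟨u, φ̂⟩`. -/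
def distributionalFourier (u : 𝓢'(ℝ, ℂ)) : 𝓢'(ℝ, ℂ) :=
  PointwiseConvergenceCLM.precomp ℂ schwartzFourier u

theorem distributionalFourier_apply (u : 𝓢'(ℝ, ℂ)) (φ : 𝓢(ℝ, ℂ)) :
    distributionalFourier u φ = u (schwartzFourier φ) := rfl

/-- The distribution `u` is an integrable function on the half-line `[A, ∞)`, namely `g`: the
function `g` is integrable there, and `⟨u, φ⟩ = ∫ φ g` for each smooth `φ` with compact support
inside the open half-line. -/
structure IsIntegrableFunctionOn (u : 𝓢'(ℝ, ℂ)) (g : ℝ → ℂ) (A : ℝ) : Prop where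
  integrableOn : IntegrableOn g (Ici A) volume
  apply_eq : ∀ φ : 𝓢(ℝ, ℂ), HasCompactSupport φ → tsupport φ ⊆ Ioi A →
    u φ = ∫ x in Ici A, φ x * g x

/-- `ρ_g(ζ) = ∫_ζ^∞ |g(t)| dt`. -/
def rho (g : ℝ → ℂ) (ζ : ℝ) : ℝ := ∫ t in Ioi ζ, ‖g t‖

/-- `log |f|` is integrable over `I`, where `log 0 = -∞`. As `Real.log 0 = 0`, it has to be said
separately that `f` is nonzero almost everywhere on `I`. -/
def LogIntegrableOn (f : ℝ → ℂ) (I : Set ℝ) : Prop :=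
  (∀ᵐ t ∂volume.restrict I, f t ≠ 0) ∧ IntegrableOn (fun t => Real.log ‖f t‖) I volume

end Clumping

end

/-!
Let `U` be the union of the bounded open intervals on which `log |f|` is integrable, and let `E` be
its complement. Each open interval that meets `E` satisfies `∫ log⁻ |f| = ∞`, and the claim is that
`f = 0` almost everywhere on `E`.

Testing the hypothesis on translates of a modulated bump function shows that `F = f ψ`, where `ψ` is
the Fourier transform of the bump, is integrable and that its classical Fourier transform is
`O(exp (-c √s))` for `s ≥ 0` (`norm_integral_mul_schwartzFourier_le`). Varying the modulation, the
zeros of `ψ` do no harm.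

Let `k = exp K` be an outer function, `K` being the Cauchy integral of a real function `σ` evaluated
slightly below the real line. Then `K` is the Fourier integral of a function `κ` on the half-line
(`halfLineFourier_cauchyDensity`), `|κ| ≤ L` with `L` proportional to `∫ |σ|`, and `|k|` is about
`exp σ`. Expanding the exponential, `∫ F (k - 1)` is a series of repeated integrals of the Fourier
transform of `F` against `κ`. The `j`-th term is at most `L ^ j / j!` times a `j`-fold iterated
integral of `exp (-c √s)`, which grows roughly like `j! (4 / c ^ 2) ^ j`; so the series converges when
`L < c ^ 2 / 4`, and `∫ F (k - 1) → 0` as soon as `κ → 0` pointwise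
(`tendsto_integral_mul_exp_halfLineFourier_sub_one`). This is where the rate `exp (-c √s)` enters.

On an interval `J` that meets `E`, put `σ = p - M` with `p ≥ 0` of mean value `M` and
`p ≤ log⁻ |f|`, which is possible as `∫_J log⁻ |f| = ∞` (`exists_isBalancedWeight`). Then `σ` has
zero mean on `J`, while `|F| exp σ ≤ exp (-M) (|F| + |ψ|)` there. Do this on all those of the `N`
equal parts of `(a, b)` that meet `E`, with `M (b - a)` small compared with `c ^ 2`. As `N → ∞`,
cancellation gives `κ → 0`, and `k → 1` away from `E ∩ [a, b]`, whereas `F k` stays of size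
`exp (-M)` on `E ∩ (a, b)`. Comparing with `∫ F (k - 1) → 0` yields
`|∫_{E ∩ (a, b)} F| ≤ exp (-M) ∫_{(a, b)} (|F| + |ψ|)` (`norm_setIntegral_inter_le_of_small`).
Differentiation in the endpoint and then `M → ∞` give `F = 0` almost everywhere on `E`.

The function `p` is chosen upper semicontinuous (Vitali–Carathéodory), so that the upper bound for
the boundary values of `|k|` follows from the continuous case and no pointwise convergence theorem
for Poisson integrals of integrable functions is needed.
-/

open scoped ENNReal NNReal

namespace Clumping

noncomputable section

/-! ### A majorant for `exp (-c √s)` adapted to repeated integration -/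

/-- A superposition of the exponentials `exp (-s / (n + 1))`. Integrating
`L * sqrtMajorant a L C j` over `[s, ∞)` gives `sqrtMajorant a L C (j + 1) s`, and for `j = 0` the
function dominates a multiple of `exp (-2 √(a s))`. -/
def sqrtMajorant (a L C : ℝ) (j : ℕ) (s : ℝ) : ℝ≥0∞ :=
  ∑' n : ℕ, ENNReal.ofReal
    (C * Real.exp (-a * (n + 1)) * (L * (n + 1)) ^ j * Real.exp (-s / (n + 1)))

/-- The sum over `j` of `sqrtMajorant a L C j / j!`. -/
def expMajorant (a L C : ℝ) (s : ℝ) : ℝ≥0∞ :=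
  ∑' n : ℕ, ENNReal.ofReal (C * Real.exp (-(a - L) * (n + 1)) * Real.exp (-s / (n + 1)))

theorem measurable_sqrtMajorant (a L C : ℝ) (j : ℕ) : Measurable (sqrtMajorant a L C j) := by
  unfold sqrtMajorant
  fun_prop

theorem measurable_expMajorant (a L C : ℝ) : Measurable (expMajorant a L C) := by
  unfold expMajorant
  fun_prop

theorem ofReal_exp_neg_sqrt_le_sqrtMajorant {c : ℝ} (hc : 0 < c) (L : ℝ) {C : ℝ} (hC : 0 ≤ C)
    {s : ℝ} (hs : 0 ≤ s) :
    ENNReal.ofReal (C * Real.exp (-c * Real.sqrt s)) ≤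
      sqrtMajorant (c ^ 2 / 4) L (C * Real.exp (c ^ 2 / 4)) 0 s := by
  -- The index balancing `a (n + 1)` against `s / (n + 1)`, where `a = c ^ 2 / 4`.
  set n : ℕ := ⌊2 * Real.sqrt s / c⌋₊
  have h0 : 0 ≤ Real.sqrt s := Real.sqrt_nonneg s
  have h1 : (n : ℝ) ≤ 2 * Real.sqrt s / c := Nat.floor_le (by positivity)
  have h2 : 2 * Real.sqrt s / c < n + 1 := Nat.lt_floor_add_one _
  have h3 : (n : ℝ) * c ≤ 2 * Real.sqrt s := (le_div_iff₀ hc).1 h1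
  have h4 : 2 * Real.sqrt s < (n + 1) * c := (div_lt_iff₀ hc).1 h2
  have h5 : s / (n + 1) ≤ c * Real.sqrt s / 2 := by
    rw [div_le_iff₀ (by positivity)]
    nlinarith [Real.mul_self_sqrt hs]
  refine le_trans ?_ (ENNReal.le_tsum n)
  refine ENNReal.ofReal_le_ofReal ?_
  rw [pow_zero, mul_one, mul_assoc, mul_assoc, ← Real.exp_add, ← Real.exp_add]
  refine mul_le_mul_of_nonneg_left (Real.exp_le_exp.2 ?_) hC
  rw [neg_div]
  nlinarith

theorem lintegral_Ioi_exp_neg_add_div {b : ℝ} (hb : 0 < b) {D : ℝ} (hD : 0 ≤ D) (s : ℝ) :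
    ∫⁻ t in Ioi (0 : ℝ), ENNReal.ofReal (D * Real.exp (-(s + t) / b)) =
      ENNReal.ofReal (D * b * Real.exp (-s / b)) := by
  have hi : IntegrableOn (fun t : ℝ => Real.exp (-b⁻¹ * t)) (Ioi 0) :=
    exp_neg_integrableOn_Ioi 0 (inv_pos.2 hb)
  have he (t : ℝ) : D * Real.exp (-(s + t) / b) =
      D * Real.exp (-s / b) * Real.exp (-b⁻¹ * t) := by
    rw [mul_assoc, ← Real.exp_add]
    congr 2
    field_simp
    ring
  simp_rw [he]
  rw [← ofReal_integral_eq_lintegral_ofReal (hi.const_mul _)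
    (Eventually.of_forall fun t => by positivity), integral_const_mul,
    integral_exp_mul_Ioi (by simpa using hb)]
  congr 1
  simp
  ring

theorem lintegral_sqrtMajorant (a : ℝ) {L C : ℝ} (hL : 0 ≤ L) (hC : 0 ≤ C) (j : ℕ) (s : ℝ) :
    ∫⁻ t in Ioi (0 : ℝ), ENNReal.ofReal L * sqrtMajorant a L C j (s + t) =
      sqrtMajorant a L C (j + 1) s := by
  unfold sqrtMajorant
  simp_rw [← ENNReal.tsum_mul_left]
  rw [lintegral_tsum (fun n => by fun_prop)]
  refine tsum_congr fun n => ?_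
  simp_rw [← ENNReal.ofReal_mul hL, ← mul_assoc]
  rw [lintegral_Ioi_exp_neg_add_div (by positivity) (by positivity)]
  congr 1
  ring

theorem tsum_sqrtMajorant_le_expMajorant (a : ℝ) {L C : ℝ} (hL : 0 ≤ L) (hC : 0 ≤ C) (s : ℝ) :
    ∑' j : ℕ, ENNReal.ofReal (1 / (j + 1).factorial) * sqrtMajorant a L C j s ≤
      expMajorant a L C s := by
  unfold sqrtMajorant expMajorant
  simp_rw [← ENNReal.tsum_mul_left]
  rw [ENNReal.tsum_comm]
  refine ENNReal.tsum_le_tsum fun n => ?_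
  have hsum : HasSum (fun j : ℕ => (L * (n + 1)) ^ j / (j.factorial : ℝ))
      (Real.exp (L * (n + 1))) := by
    rw [Real.exp_eq_exp_ℝ]
    exact NormedSpace.expSeries_div_hasSum_exp _
  set D : ℝ := C * Real.exp (-a * (n + 1)) * Real.exp (-s / (n + 1))
  have hD : 0 ≤ D := by positivity
  calc ∑' j : ℕ, ENNReal.ofReal (1 / (j + 1).factorial) * ENNReal.ofReal
        (C * Real.exp (-a * (n + 1)) * (L * (n + 1)) ^ j * Real.exp (-s / (n + 1)))
      ≤ ∑' j : ℕ, ENNReal.ofReal (D * ((L * (n + 1)) ^ j / (j.factorial : ℝ))) := by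
        refine ENNReal.tsum_le_tsum fun j => ?_
        rw [← ENNReal.ofReal_mul (by positivity)]
        refine ENNReal.ofReal_le_ofReal ?_
        have h : (1 : ℝ) / (j + 1).factorial ≤ 1 / j.factorial :=
          one_div_le_one_div_of_le (by positivity)
            (by exact_mod_cast Nat.factorial_le (Nat.le_succ j))
        calc _ ≤ 1 / (j.factorial : ℝ) *
              (C * Real.exp (-a * (n + 1)) * (L * (n + 1)) ^ j * Real.exp (-s / (n + 1))) :=
              mul_le_mul_of_nonneg_right h (by positivity)
          _ = _ := by simp only [D]; ring
    _ = ENNReal.ofReal (D * Real.exp (L * (n + 1))) := by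
        rw [← (hsum.mul_left D).tsum_eq,
          ENNReal.ofReal_tsum_of_nonneg (fun j => by positivity) (hsum.mul_left D).summable]
    _ = _ := by
        congr 1
        simp only [D]
        rw [show -(a - L) * ((n : ℝ) + 1) = -a * (n + 1) + L * (n + 1) by ring, Real.exp_add]
        ring
    _ ≤ _ := le_rfl

theorem lintegral_expMajorant_ne_top {a L C : ℝ} (hLa : L < a) (hC : 0 ≤ C) :
    ∫⁻ t in Ioi (0 : ℝ), expMajorant a L C t ≠ ∞ := by
  unfold expMajorant
  rw [lintegral_tsum (fun n => by fun_prop)]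
  have h (n : ℕ) : ∫⁻ t in Ioi (0 : ℝ), ENNReal.ofReal
      (C * Real.exp (-(a - L) * (n + 1)) * Real.exp (-t / (n + 1))) =
      ENNReal.ofReal (C * (((n + 1 : ℕ) : ℝ) ^ 1 * Real.exp (-(a - L) * (n + 1 : ℕ)))) := by
    have := lintegral_Ioi_exp_neg_add_div (b := (n : ℝ) + 1) (by positivity)
      (D := C * Real.exp (-(a - L) * (n + 1))) (by positivity) 0
    simp only [zero_add] at this
    rw [this]
    congr 1
    simp
    ring
  simp_rw [h]
  have hs : Summable fun n : ℕ => (n : ℝ) ^ 1 * Real.exp (-(a - L) * n) :=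
    Real.summable_pow_mul_exp_neg_nat_mul 1 (sub_pos.2 hLa)
  exact (((summable_nat_add_iff 1).2 hs).mul_left C).tsum_ofReal_ne_top

/-! ### Multiplication by exponentials of one-sided Fourier integrals -/

/-- The Fourier integral `x ↦ ∫_0^∞ κ(s) e^{-isx} ds` of a function on the half-line. -/
def halfLineFourier (κ : ℝ → ℂ) (x : ℝ) : ℂ :=
  ∫ s in Ioi (0 : ℝ), κ s * Complex.exp (-Complex.I * x * s)

theorem norm_exp_neg_I_mul (x s : ℝ) : ‖Complex.exp (-Complex.I * x * s)‖ = 1 := by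
  rw [show -Complex.I * x * s = ((-(x * s) : ℝ) : ℂ) * Complex.I by push_cast; ring]
  exact Complex.norm_exp_ofReal_mul_I _

theorem continuous_halfLineFourier {κ : ℝ → ℂ} (hκ : IntegrableOn κ (Ioi 0)) :
    Continuous (halfLineFourier κ) := by
  refine continuous_of_dominated (bound := fun s => ‖κ s‖) (fun x => ?_) (fun x => ?_) hκ.norm ?_
  · exact hκ.aestronglyMeasurable.mul (by fun_prop)
  · exact Eventually.of_forall fun s => by rw [norm_mul, norm_exp_neg_I_mul, mul_one]
  · exact Eventually.of_forall fun s => by fun_prop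

theorem norm_halfLineFourier_le (κ : ℝ → ℂ) (x : ℝ) :
    ‖halfLineFourier κ x‖ ≤ ∫ s in Ioi (0 : ℝ), ‖κ s‖ := by
  refine (norm_integral_le_integral_norm _).trans_eq ?_
  simp_rw [norm_mul, norm_exp_neg_I_mul, mul_one]

theorem integrable_mul_halfLineFourier_pow {F κ : ℝ → ℂ} (hF : Integrable F)
    (hκ : IntegrableOn κ (Ioi 0)) (j : ℕ) :
    Integrable fun x => F x * halfLineFourier κ x ^ j := by
  refine hF.mul_bdd (c := (∫ s in Ioi (0 : ℝ), ‖κ s‖) ^ j)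
    ((continuous_halfLineFourier hκ).pow j).aestronglyMeasurable (Eventually.of_forall fun x => ?_)
  rw [norm_pow]
  exact pow_le_pow_left₀ (norm_nonneg _) (norm_halfLineFourier_le κ x) j

/-- Multiplying by `halfLineFourier κ` on one side amounts to correlating with `κ` on the other. -/
theorem integral_mul_halfLineFourier {F κ : ℝ → ℂ} (hF : Integrable F)
    (hκ : IntegrableOn κ (Ioi 0)) (s : ℝ) :
    ∫ x : ℝ, F x * halfLineFourier κ x * Complex.exp (-Complex.I * x * s) =
      ∫ t in Ioi (0 : ℝ), κ t * ∫ x : ℝ, F x * Complex.exp (-Complex.I * x * (s + t : ℝ)) := by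
  have hi : Integrable (fun p : ℝ × ℝ => F p.1 * κ p.2 *
      Complex.exp (-Complex.I * p.1 * (s + p.2 : ℝ))) (volume.prod (volume.restrict (Ioi 0))) := by
    refine (Integrable.mul_prod hF hκ).mul_bdd (c := 1) (by fun_prop)
      (Eventually.of_forall fun p => ?_)
    rw [norm_exp_neg_I_mul]
  calc ∫ x : ℝ, F x * halfLineFourier κ x * Complex.exp (-Complex.I * x * s)
      = ∫ x : ℝ, ∫ t in Ioi (0 : ℝ), F x * κ t *
          Complex.exp (-Complex.I * x * (s + t : ℝ)) := by
        refine integral_congr_ae (Eventually.of_forall fun x => ?_)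
        simp only [halfLineFourier]
        rw [mul_right_comm, ← integral_const_mul]
        refine integral_congr_ae (Eventually.of_forall fun t => ?_)
        simp only
        rw [show -Complex.I * x * (s + t : ℝ) = -Complex.I * x * s + -Complex.I * x * t by
          push_cast; ring, Complex.exp_add]
        ring
    _ = ∫ t in Ioi (0 : ℝ), ∫ x : ℝ, F x * κ t *
          Complex.exp (-Complex.I * x * (s + t : ℝ)) := integral_integral_swap hi
    _ = _ := by
        refine integral_congr_ae (Eventually.of_forall fun t => ?_)
        simp only
        rw [← integral_const_mul]
        refine integral_congr_ae (Eventually.of_forall fun x => ?_)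
        simp only
        ring

/-- The moments `∫ F K ^ j e^{-isx} dx` are controlled for `s ≥ 0` by the iterated integrals of
the bound on the Fourier transform of `F`. -/
theorem enorm_integral_mul_halfLineFourier_pow_le {F κ : ℝ → ℂ} (hF : Integrable F)
    (hκ : IntegrableOn κ (Ioi 0)) {c C L : ℝ} (hc : 0 < c) (hC : 0 ≤ C) (hL : 0 ≤ L)
    (hκL : ∀ s > 0, ‖κ s‖ ≤ L)
    (hFC : ∀ s : ℝ, 0 ≤ s → ‖∫ x : ℝ, F x * Complex.exp (-Complex.I * x * s)‖ ≤
      C * Real.exp (-c * Real.sqrt s)) (j : ℕ) {s : ℝ} (hs : 0 ≤ s) :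
    ‖∫ x : ℝ, F x * halfLineFourier κ x ^ j * Complex.exp (-Complex.I * x * s)‖ₑ ≤
      sqrtMajorant (c ^ 2 / 4) L (C * Real.exp (c ^ 2 / 4)) j s := by
  induction j generalizing s with
  | zero =>
    refine le_trans ?_ (ofReal_exp_neg_sqrt_le_sqrtMajorant hc L hC hs)
    rw [← ofReal_norm]
    simpa using ENNReal.ofReal_le_ofReal (hFC s hs)
  | succ j ih =>
    simp_rw [pow_succ, ← mul_assoc]
    rw [integral_mul_halfLineFourier (integrable_mul_halfLineFourier_pow hF hκ j) hκ s,
      ← lintegral_sqrtMajorant _ hL (by positivity)]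
    refine (enorm_integral_le_lintegral_enorm _).trans ?_
    refine setLIntegral_mono' measurableSet_Ioi fun t ht => ?_
    rw [enorm_mul]
    refine mul_le_mul' ?_ (ih (add_nonneg hs (mem_Ioi.1 ht).le))
    rw [← ofReal_norm]
    exact ENNReal.ofReal_le_ofReal (hκL t ht)

/-- If the Fourier transform of `F` is `O(exp (-c √s))` on the positive half-line and
`|κ| ≤ L < c ^ 2 / 4`, then `∫ F (exp K - 1)`, where `K = halfLineFourier κ`, is dominated by the
integral of `|κ|` against an integrable function that does not depend on `κ`. -/
theorem enorm_integral_mul_exp_halfLineFourier_sub_one_le {F κ : ℝ → ℂ} (hF : Integrable F)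
    (hκ : IntegrableOn κ (Ioi 0)) {c C L : ℝ} (hc : 0 < c) (hC : 0 ≤ C) (hL : 0 ≤ L)
    (hκL : ∀ s > 0, ‖κ s‖ ≤ L)
    (hFC : ∀ s : ℝ, 0 ≤ s → ‖∫ x : ℝ, F x * Complex.exp (-Complex.I * x * s)‖ ≤
      C * Real.exp (-c * Real.sqrt s)) :
    ‖∫ x : ℝ, F x * (Complex.exp (halfLineFourier κ x) - 1)‖ₑ ≤
      ∫⁻ t in Ioi (0 : ℝ), ‖κ t‖ₑ * expMajorant (c ^ 2 / 4) L (C * Real.exp (c ^ 2 / 4)) t := by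
  set K := halfLineFourier κ
  set Q : ℝ := ∫ s in Ioi (0 : ℝ), ‖κ s‖
  have hQ : 0 ≤ Q := integral_nonneg fun _ => norm_nonneg _
  set C' := C * Real.exp (c ^ 2 / 4)
  have hexp (z : ℂ) : HasSum (fun j : ℕ => ((1 / (j + 1).factorial : ℝ) : ℂ) * z ^ (j + 1))
      (Complex.exp z - 1) := by
    have h : HasSum (fun j : ℕ => z ^ j / (j.factorial : ℂ)) (Complex.exp z) := by
      rw [Complex.exp_eq_exp_ℂ]
      exact NormedSpace.expSeries_div_hasSum_exp _
    rw [hasSum_nat_add_iff' 1 |>.symm] at h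
    simp only [Finset.sum_range_one, pow_zero, Nat.factorial_zero, Nat.cast_one, div_one] at h
    refine h.congr_fun ?_
    intro j
    push_cast
    ring
  have hreal : Summable fun j : ℕ => 1 / ((j + 1).factorial : ℝ) * Q ^ (j + 1) := by
    have h := (summable_nat_add_iff 1).2 (Real.summable_pow_div_factorial Q)
    refine h.congr fun j => by ring
  -- Expanding the exponential turns the integral into a series of moments.
  have hsum : HasSum (fun j : ℕ => ∫ x : ℝ, F x * (((1 / (j + 1).factorial : ℝ) : ℂ) *
      K x ^ (j + 1))) (∫ x : ℝ, F x * (Complex.exp (K x) - 1)) := by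
    refine hasSum_integral_of_dominated_convergence
      (fun j x => ‖F x‖ * (1 / ((j + 1).factorial : ℝ) * Q ^ (j + 1))) (fun j => ?_) (fun j => ?_)
      ?_ ?_ ?_
    · exact hF.aestronglyMeasurable.mul
        (((continuous_halfLineFourier hκ).pow _).const_mul _).aestronglyMeasurable
    · refine Eventually.of_forall fun x => ?_
      rw [norm_mul, norm_mul, Complex.norm_real, Real.norm_of_nonneg (by positivity), norm_pow]
      have := pow_le_pow_left₀ (norm_nonneg _) (norm_halfLineFourier_le κ x) (j + 1)
      gcongr
    · exact Eventually.of_forall fun x => hreal.mul_left _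
    · simp_rw [tsum_mul_left]
      exact hF.norm.mul_const _
    · exact Eventually.of_forall fun x => (hexp (K x)).mul_left _
  rw [← hsum.tsum_eq]
  have hterm (j : ℕ) : ‖∫ x : ℝ, F x * (((1 / (j + 1).factorial : ℝ) : ℂ) * K x ^ (j + 1))‖ₑ ≤
      ∫⁻ t in Ioi (0 : ℝ), ‖κ t‖ₑ *
        (ENNReal.ofReal (1 / (j + 1).factorial) * sqrtMajorant (c ^ 2 / 4) L C' j t) := by
    have h1 : ∫ x : ℝ, F x * (((1 / (j + 1).factorial : ℝ) : ℂ) * K x ^ (j + 1)) =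
        ((1 / (j + 1).factorial : ℝ) : ℂ) * ∫ t in Ioi (0 : ℝ), κ t *
          ∫ x : ℝ, F x * K x ^ j * Complex.exp (-Complex.I * x * (0 + t : ℝ)) := by
      rw [← integral_mul_halfLineFourier (integrable_mul_halfLineFourier_pow hF hκ j) hκ 0,
        ← integral_const_mul]
      refine integral_congr_ae (Eventually.of_forall fun x => ?_)
      simp only [K, Complex.ofReal_zero, mul_zero, Complex.exp_zero, mul_one]
      ring
    rw [h1, enorm_mul, ← ofReal_norm (((1 / (j + 1).factorial : ℝ) : ℂ)), Complex.norm_real,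
      Real.norm_of_nonneg (by positivity)]
    calc _ ≤ ENNReal.ofReal (1 / (j + 1).factorial) * ∫⁻ t in Ioi (0 : ℝ), ‖κ t‖ₑ *
          sqrtMajorant (c ^ 2 / 4) L C' j t := by
          refine mul_le_mul' le_rfl ((enorm_integral_le_lintegral_enorm _).trans ?_)
          refine setLIntegral_mono' measurableSet_Ioi fun t ht => ?_
          rw [enorm_mul, zero_add]
          exact mul_le_mul' le_rfl (enorm_integral_mul_halfLineFourier_pow_le hF hκ hc hC hL hκL
            hFC j (mem_Ioi.1 ht).le)
      _ = _ := by
          rw [← lintegral_const_mul' _ _ ENNReal.ofReal_ne_top]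
          refine lintegral_congr fun t => by ring
  have hkm : AEMeasurable (fun t => ‖κ t‖ₑ) (volume.restrict (Ioi 0)) :=
    hκ.aestronglyMeasurable.enorm
  calc _ ≤ ∑' j : ℕ, ‖∫ x : ℝ, F x * (((1 / (j + 1).factorial : ℝ) : ℂ) * K x ^ (j + 1))‖ₑ :=
        enorm_tsum_le_tsum_enorm
    _ ≤ ∑' j : ℕ, ∫⁻ t in Ioi (0 : ℝ), ‖κ t‖ₑ *
        (ENNReal.ofReal (1 / (j + 1).factorial) * sqrtMajorant (c ^ 2 / 4) L C' j t) :=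
        ENNReal.tsum_le_tsum hterm
    _ = ∫⁻ t in Ioi (0 : ℝ), ‖κ t‖ₑ * ∑' j : ℕ,
        (ENNReal.ofReal (1 / (j + 1).factorial) * sqrtMajorant (c ^ 2 / 4) L C' j t) := by
        rw [← lintegral_tsum]
        · simp_rw [ENNReal.tsum_mul_left]
        · exact fun j => hkm.mul ((measurable_sqrtMajorant _ _ _ j).const_mul _).aemeasurable
    _ ≤ _ := lintegral_mono fun t => mul_le_mul' le_rfl
        (tsum_sqrtMajorant_le_expMajorant _ hL (by positivity) t)

/-- If the kernels `κ m` are uniformly bounded by `L < c ^ 2 / 4` and tend to `0` pointwise, then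
`∫ F exp K_m → ∫ F`, where `K_m = halfLineFourier (κ m)`. -/
theorem tendsto_integral_mul_exp_halfLineFourier_sub_one {F : ℝ → ℂ} (hF : Integrable F)
    {κ : ℕ → ℝ → ℂ} (hκ : ∀ m, IntegrableOn (κ m) (Ioi 0)) {c C L : ℝ} (hc : 0 < c) (hC : 0 ≤ C)
    (hL : 0 ≤ L) (hLc : L < c ^ 2 / 4) (hκL : ∀ m, ∀ s > 0, ‖κ m s‖ ≤ L)
    (hκ0 : ∀ s > 0, Tendsto (fun m => κ m s) atTop (𝓝 0))
    (hFC : ∀ s : ℝ, 0 ≤ s → ‖∫ x : ℝ, F x * Complex.exp (-Complex.I * x * s)‖ ≤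
      C * Real.exp (-c * Real.sqrt s)) :
    Tendsto (fun m => ∫ x : ℝ, F x * (Complex.exp (halfLineFourier (κ m) x) - 1)) atTop
      (𝓝 0) := by
  set V := expMajorant (c ^ 2 / 4) L (C * Real.exp (c ^ 2 / 4))
  have hVm : Measurable V := measurable_expMajorant _ _ _
  have hV : ∫⁻ t in Ioi (0 : ℝ), V t ≠ ∞ := lintegral_expMajorant_ne_top hLc (by positivity)
  have hlim : Tendsto (fun m => ∫⁻ t in Ioi (0 : ℝ), ‖κ m t‖ₑ * V t) atTop
      (𝓝 (∫⁻ _ in Ioi (0 : ℝ), 0)) := by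
    refine tendsto_lintegral_of_dominated_convergence' (fun t => ENNReal.ofReal L * V t)
      (fun m => (hκ m).aestronglyMeasurable.enorm.mul hVm.aemeasurable) (fun m => ?_) ?_ ?_
    · refine (ae_restrict_iff' measurableSet_Ioi).2 (Eventually.of_forall fun t ht => ?_)
      refine mul_le_mul' ?_ le_rfl
      rw [← ofReal_norm]
      exact ENNReal.ofReal_le_ofReal (hκL m t ht)
    · rw [lintegral_const_mul _ hVm]
      exact ENNReal.mul_ne_top ENNReal.ofReal_ne_top hV
    · filter_upwards [ae_restrict_mem measurableSet_Ioi, ae_lt_top hVm hV] with t ht hVt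
      have h := ENNReal.Tendsto.mul_const (b := V t) ((hκ0 t ht).enorm) (Or.inr hVt.ne)
      simpa using h
  rw [lintegral_zero] at hlim
  rw [tendsto_zero_iff_enorm_tendsto_zero]
  exact tendsto_of_tendsto_of_tendsto_of_le_of_le tendsto_const_nhds hlim (fun _ => zero_le)
    fun m => enorm_integral_mul_exp_halfLineFourier_sub_one_le hF (hκ m) hc hC hL (hκL m) hFC

/-! ### Cauchy and Poisson integrals of real functions -/

/-- The function on the half-line whose Fourier integral is the Cauchy integral of `σ` at height
`δ` below the real line; see `halfLineFourier_cauchyDensity`. -/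
def cauchyDensity (σ : ℝ → ℝ) (δ s : ℝ) : ℂ :=
  ((Real.pi⁻¹ * Real.exp (-δ * s) : ℝ) : ℂ) * ∫ t : ℝ, (σ t : ℂ) * Complex.exp (Complex.I * s * t)

theorem norm_exp_I_mul (s t : ℝ) : ‖Complex.exp (Complex.I * s * t)‖ = 1 := by
  rw [show Complex.I * s * t = ((s * t : ℝ) : ℂ) * Complex.I by push_cast; ring]
  exact Complex.norm_exp_ofReal_mul_I _

theorem norm_cauchyDensity_le_mul_exp (σ : ℝ → ℝ) (δ s : ℝ) :
    ‖cauchyDensity σ δ s‖ ≤ Real.pi⁻¹ * (∫ t : ℝ, |σ t|) * Real.exp (-δ * s) := by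
  have h : ‖∫ t : ℝ, (σ t : ℂ) * Complex.exp (Complex.I * s * t)‖ ≤ ∫ t : ℝ, |σ t| := by
    refine (norm_integral_le_integral_norm _).trans_eq ?_
    simp_rw [norm_mul, norm_exp_I_mul, mul_one, Complex.norm_real, Real.norm_eq_abs]
  rw [cauchyDensity, norm_mul, Complex.norm_real, Real.norm_of_nonneg (by positivity)]
  calc _ ≤ Real.pi⁻¹ * Real.exp (-δ * s) * ∫ t : ℝ, |σ t| := by gcongr
    _ = _ := by ring

theorem norm_cauchyDensity_le (σ : ℝ → ℝ) {δ s : ℝ} (hδ : 0 ≤ δ) (hs : 0 ≤ s) :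
    ‖cauchyDensity σ δ s‖ ≤ Real.pi⁻¹ * ∫ t : ℝ, |σ t| := by
  refine (norm_cauchyDensity_le_mul_exp σ δ s).trans (mul_le_of_le_one_right ?_ ?_)
  · exact mul_nonneg (by positivity) (integral_nonneg fun _ => abs_nonneg _)
  · exact Real.exp_le_one_iff.2 (by nlinarith)

theorem integrableOn_cauchyDensity {σ : ℝ → ℝ} (hσ : Integrable σ) {δ : ℝ} (hδ : 0 < δ) :
    IntegrableOn (cauchyDensity σ δ) (Ioi 0) := by
  have hc : Continuous (cauchyDensity σ δ) := by
    refine Continuous.mul (by fun_prop) ?_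
    refine continuous_of_dominated (bound := fun t => |σ t|) (fun s => ?_) (fun s => ?_)
      hσ.norm ?_
    · exact hσ.ofReal.aestronglyMeasurable.mul (by fun_prop)
    · exact Eventually.of_forall fun t => by
        rw [norm_mul, norm_exp_I_mul, mul_one, Complex.norm_real, Real.norm_eq_abs]
    · exact Eventually.of_forall fun t => by fun_prop
  exact ((exp_neg_integrableOn_Ioi 0 hδ).const_mul _).mono' hc.aestronglyMeasurable
    (Eventually.of_forall (norm_cauchyDensity_le_mul_exp σ δ))

/-- The Fourier integral of `cauchyDensity σ δ` is the Cauchy integral of `σ`. -/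
theorem halfLineFourier_cauchyDensity {σ : ℝ → ℝ} (hσ : Integrable σ) {δ : ℝ} (hδ : 0 < δ)
    (x : ℝ) : halfLineFourier (cauchyDensity σ δ) x =
      (Real.pi⁻¹ : ℝ) * ∫ t : ℝ, (σ t : ℂ) * (δ + Complex.I * (x - t))⁻¹ := by
  have hi : Integrable (fun p : ℝ × ℝ => ((Real.exp (-δ * p.1) : ℝ) : ℂ) * (σ p.2 : ℂ) *
      Complex.exp (Complex.I * p.1 * (p.2 - x : ℝ)))
      ((volume.restrict (Ioi 0)).prod volume) := by
    refine (Integrable.mul_prod (f := fun s : ℝ => ((Real.exp (-δ * s) : ℝ) : ℂ))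
      (g := fun t => (σ t : ℂ)) ?_ hσ.ofReal).mul_bdd (c := 1) (by fun_prop)
      (Eventually.of_forall fun p => ?_)
    · exact (exp_neg_integrableOn_Ioi 0 hδ).ofReal
    · rw [norm_exp_I_mul]
  calc halfLineFourier (cauchyDensity σ δ) x
      = (Real.pi⁻¹ : ℝ) * ∫ s in Ioi (0 : ℝ), ∫ t : ℝ, ((Real.exp (-δ * s) : ℝ) : ℂ) * (σ t : ℂ) *
          Complex.exp (Complex.I * s * (t - x : ℝ)) := by
        rw [halfLineFourier, ← integral_const_mul]
        refine integral_congr_ae (Eventually.of_forall fun s => ?_)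
        simp only [cauchyDensity]
        rw [mul_assoc, ← integral_mul_const, ← integral_const_mul, ← integral_const_mul]
        refine integral_congr_ae (Eventually.of_forall fun t => ?_)
        simp only
        rw [show Complex.I * s * (t - x : ℝ) = Complex.I * s * t + -Complex.I * x * s by
          push_cast; ring, Complex.exp_add]
        push_cast
        ring
    _ = (Real.pi⁻¹ : ℝ) * ∫ t : ℝ, ∫ s in Ioi (0 : ℝ), ((Real.exp (-δ * s) : ℝ) : ℂ) * (σ t : ℂ) *
          Complex.exp (Complex.I * s * (t - x : ℝ)) := by rw [integral_integral_swap hi]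
    _ = _ := by
        congr 1
        refine integral_congr_ae (Eventually.of_forall fun t => ?_)
        simp only
        have h (s : ℝ) : ((Real.exp (-δ * s) : ℝ) : ℂ) * (σ t : ℂ) *
            Complex.exp (Complex.I * s * (t - x : ℝ)) =
            (σ t : ℂ) * Complex.exp (-(δ + Complex.I * (x - t)) * s) := by
          rw [mul_comm _ (σ t : ℂ), mul_assoc, Complex.ofReal_exp, ← Complex.exp_add]
          congr 2
          push_cast
          ring
        simp_rw [h]
        rw [integral_const_mul, integral_exp_mul_complex_Ioi (by simpa using hδ)]
        rw [Complex.ofReal_zero, mul_zero, Complex.exp_zero, neg_div_neg_eq, one_div]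

/-- The real part of a Cauchy integral is a Poisson integral, written here after rescaling. -/
theorem re_halfLineFourier_cauchyDensity {σ : ℝ → ℝ} (hσ : Integrable σ) {δ : ℝ} (hδ : 0 < δ)
    (x : ℝ) : (halfLineFourier (cauchyDensity σ δ) x).re =
      Real.pi⁻¹ * ∫ u : ℝ, σ (x + δ * u) * (1 + u ^ 2)⁻¹ := by
  have hne (t : ℝ) : (δ : ℂ) + Complex.I * (x - t) ≠ 0 := fun h => by
    have := congrArg Complex.re h
    simp at this
    exact hδ.ne' this
  have hre (t : ℝ) : ((δ : ℂ) + Complex.I * (x - t)).re = δ := by simp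
  have him (t : ℝ) : ((δ : ℂ) + Complex.I * (x - t)).im = x - t := by simp
  have hi : Integrable fun t : ℝ => (σ t : ℂ) * (δ + Complex.I * (x - t))⁻¹ := by
    refine hσ.ofReal.mul_bdd (c := δ⁻¹) ?_ (Eventually.of_forall fun t => ?_)
    · exact (Continuous.inv₀ (by fun_prop) hne).aestronglyMeasurable
    · rw [norm_inv]
      refine inv_anti₀ hδ ?_
      have := Complex.abs_re_le_norm ((δ : ℂ) + Complex.I * (x - t))
      rwa [hre, abs_of_pos hδ] at this
  rw [halfLineFourier_cauchyDensity hσ hδ, Complex.re_ofReal_mul]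
  congr 1
  have h1 := integral_re hi
  simp only [RCLike.re_to_complex] at h1
  rw [← h1]
  have h2 (t : ℝ) : ((σ t : ℂ) * (δ + Complex.I * (x - t))⁻¹).re =
      σ t * (δ / (δ ^ 2 + (x - t) ^ 2)) := by
    rw [Complex.re_ofReal_mul, Complex.inv_re, Complex.normSq_apply, hre, him]
    ring
  simp_rw [h2]
  rw [← integral_add_left_eq_self (fun t : ℝ => σ t * (δ / (δ ^ 2 + (x - t) ^ 2))) x]
  have h3 := Measure.integral_comp_mul_left
    (fun t : ℝ => σ (x + t) * (δ / (δ ^ 2 + (x - (x + t)) ^ 2))) δ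
  rw [abs_of_pos (inv_pos.2 hδ), smul_eq_mul, eq_inv_mul_iff_mul_eq₀ hδ.ne',
    ← integral_const_mul] at h3
  rw [← h3]
  refine integral_congr_ae (Eventually.of_forall fun u => ?_)
  simp only
  have h4 : (0 : ℝ) < 1 + u ^ 2 := by positivity
  have h5 : (0 : ℝ) < δ ^ 2 + (x - (x + δ * u)) ^ 2 := by positivity
  field_simp
  ring

theorem integrable_comp_mul_inv_one_add_sq {σ : ℝ → ℝ} (hσm : AEStronglyMeasurable σ) {S : ℝ}
    (hS : ∀ t, |σ t| ≤ S) {δ : ℝ} (hδ : δ ≠ 0) (x : ℝ) :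
    Integrable fun u : ℝ => σ (x + δ * u) * (1 + u ^ 2)⁻¹ := by
  refine integrable_inv_one_add_sq.bdd_mul (c := S) ?_ (Eventually.of_forall fun u => hS _)
  have hq : Measure.QuasiMeasurePreserving (fun u : ℝ => x + δ * u) := by
    have h1 : Measure.QuasiMeasurePreserving (fun u : ℝ => δ * u) :=
      ⟨by fun_prop, by
        rw [Real.map_volume_mul_left hδ]
        exact Measure.smul_absolutelyContinuous⟩
    exact (measurePreserving_add_left volume x).quasiMeasurePreserving.comp h1
  exact hσm.comp_quasiMeasurePreserving hq

theorem re_halfLineFourier_cauchyDensity_le {σ : ℝ → ℝ} (hσ : Integrable σ) {S : ℝ}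
    (hS : ∀ t, |σ t| ≤ S) {δ : ℝ} (hδ : 0 < δ) (x : ℝ) :
    (halfLineFourier (cauchyDensity σ δ) x).re ≤ S := by
  rw [re_halfLineFourier_cauchyDensity hσ hδ, inv_mul_le_iff₀ Real.pi_pos]
  calc _ ≤ ∫ u : ℝ, S * (1 + u ^ 2)⁻¹ := by
        refine integral_mono (integrable_comp_mul_inv_one_add_sq hσ.aestronglyMeasurable hS hδ.ne' x)
          (integrable_inv_one_add_sq.const_mul S) fun u => ?_
        exact mul_le_mul_of_nonneg_right ((le_abs_self _).trans (hS _)) (by positivity)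
    _ = _ := by rw [integral_const_mul, integral_univ_inv_one_add_sq, mul_comm]

/-- At a point of upper semicontinuity, the upper limit of Poisson integrals is at most the value
of the function. -/
theorem eventually_re_halfLineFourier_cauchyDensity_lt {σ : ℝ → ℝ} (hσ : Integrable σ) {S : ℝ}
    (hS : ∀ t, |σ t| ≤ S) {x : ℝ} (hx : UpperSemicontinuousAt σ x) {v : ℝ} (hv : σ x < v) :
    ∀ᶠ δ in 𝓝[>] (0 : ℝ), (halfLineFourier (cauchyDensity σ δ) x).re < v := by
  -- The majorant `max σ (σ x)` is continuous at `x`, so dominated convergence applies to it.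
  set τ : ℝ → ℝ := fun t => max (σ t) (σ x)
  have hτm : AEStronglyMeasurable τ :=
    (hσ.aestronglyMeasurable.aemeasurable.max aemeasurable_const).aestronglyMeasurable
  have hτS (t : ℝ) : |τ t| ≤ S := by
    rcases max_choice (σ t) (σ x) with h | h <;> simp only [τ, h, hS]
  have hτx : Tendsto τ (𝓝 x) (𝓝 (σ x)) := by
    refine tendsto_order.2 ⟨fun a ha => Eventually.of_forall fun t => lt_max_of_lt_right ha,
      fun a ha => ?_⟩
    filter_upwards [hx a ha] with t ht
    exact max_lt ht ha
  have hlim : Tendsto (fun δ : ℝ => Real.pi⁻¹ * ∫ u : ℝ, τ (x + δ * u) * (1 + u ^ 2)⁻¹)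
      (𝓝[>] 0) (𝓝 (Real.pi⁻¹ * ∫ u : ℝ, σ x * (1 + u ^ 2)⁻¹)) := by
    refine Tendsto.const_mul _ (tendsto_integral_filter_of_dominated_convergence
      (fun u => S * (1 + u ^ 2)⁻¹) ?_ ?_ (integrable_inv_one_add_sq.const_mul S) ?_)
    · filter_upwards [self_mem_nhdsWithin] with δ hδ
      exact (integrable_comp_mul_inv_one_add_sq hτm hτS (mem_Ioi.1 hδ).ne' x).aestronglyMeasurable
    · refine Eventually.of_forall fun δ => Eventually.of_forall fun u => ?_
      rw [norm_mul, Real.norm_of_nonneg (by positivity : (0 : ℝ) ≤ (1 + u ^ 2)⁻¹)]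
      exact mul_le_mul_of_nonneg_right (hτS _) (by positivity)
    · refine Eventually.of_forall fun u => Tendsto.mul_const _ (hτx.comp ?_)
      have : Tendsto (fun δ : ℝ => x + δ * u) (𝓝 0) (𝓝 (x + 0 * u)) :=
        Continuous.tendsto (by fun_prop) 0
      rw [zero_mul, add_zero] at this
      exact this.mono_left nhdsWithin_le_nhds
  rw [integral_const_mul, integral_univ_inv_one_add_sq, mul_left_comm,
    inv_mul_cancel₀ Real.pi_ne_zero, mul_one] at hlim
  filter_upwards [(tendsto_order.1 hlim).2 v hv, self_mem_nhdsWithin] with δ h hδ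
  refine lt_of_le_of_lt ?_ h
  rw [re_halfLineFourier_cauchyDensity hσ hδ]
  refine mul_le_mul_of_nonneg_left ?_ (by positivity)
  refine integral_mono
    (integrable_comp_mul_inv_one_add_sq hσ.aestronglyMeasurable hS (mem_Ioi.1 hδ).ne' x)
    (integrable_comp_mul_inv_one_add_sq hτm hτS (mem_Ioi.1 hδ).ne' x) fun u => ?_
  exact mul_le_mul_of_nonneg_right (le_max_left _ _) (by positivity)

/-- The boundary modulus of the outer function with boundary data `exp σ` is asymptotically at
most `exp σ`, in the sense of integrals against an integrable weight. -/
theorem tendsto_integral_norm_mul_exp_halfLineFourier_excess {F : ℝ → ℂ} (hF : Integrable F)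
    {σ : ℝ → ℝ} (hσ : Integrable σ) {S : ℝ} (hS : ∀ t, |σ t| ≤ S)
    (husc : ∀ᵐ x, UpperSemicontinuousAt σ x) :
    Tendsto (fun δ : ℝ => ∫ x : ℝ, ‖F x‖ *
      max 0 (‖Complex.exp (halfLineFourier (cauchyDensity σ δ) x)‖ - Real.exp (σ x)))
      (𝓝[>] 0) (𝓝 0) := by
  suffices h : Tendsto (fun δ : ℝ => ∫ x : ℝ, ‖F x‖ *
      max 0 (‖Complex.exp (halfLineFourier (cauchyDensity σ δ) x)‖ - Real.exp (σ x)))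
      (𝓝[>] 0) (𝓝 (∫ x : ℝ, ‖F x‖ * 0)) by simpa using h
  refine tendsto_integral_filter_of_dominated_convergence (fun x => ‖F x‖ * Real.exp S) ?_ ?_
    (hF.norm.mul_const _) ?_
  · filter_upwards [self_mem_nhdsWithin] with δ hδ
    refine hF.aestronglyMeasurable.norm.mul ?_
    have h1 : AEMeasurable fun x =>
        ‖Complex.exp (halfLineFourier (cauchyDensity σ δ) x)‖ - Real.exp (σ x) := by
      refine AEMeasurable.sub ?_ (Real.measurable_exp.comp_aemeasurable hσ.aemeasurable)
      exact (Complex.continuous_exp.comp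
        (continuous_halfLineFourier (integrableOn_cauchyDensity hσ hδ))).norm.aemeasurable
    exact (aemeasurable_const.max h1).aestronglyMeasurable
  · filter_upwards [self_mem_nhdsWithin] with δ hδ
    refine Eventually.of_forall fun x => ?_
    rw [norm_mul, norm_norm, Real.norm_of_nonneg (le_max_left _ _)]
    refine mul_le_mul_of_nonneg_left (max_le (Real.exp_pos _).le ?_) (norm_nonneg _)
    rw [Complex.norm_exp]
    have := Real.exp_le_exp.2 (re_halfLineFourier_cauchyDensity_le hσ hS hδ x)
    linarith [Real.exp_pos (σ x)]
  · filter_upwards [husc] with x hx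
    refine Tendsto.const_mul _ (tendsto_order.2 ⟨fun a ha => Eventually.of_forall fun δ =>
      lt_of_lt_of_le ha (le_max_left _ _), fun a ha => ?_⟩)
    have hlt : σ x < Real.log (Real.exp (σ x) + a) := by
      rw [Real.lt_log_iff_exp_lt (by positivity)]
      linarith
    filter_upwards [eventually_re_halfLineFourier_cauchyDensity_lt hσ hS hx hlt] with δ h
    refine max_lt ha ?_
    rw [Complex.norm_exp]
    rw [Real.lt_log_iff_exp_lt (by positivity)] at h
    linarith

/-! ### Weights balanced on intervals with divergent logarithmic integral -/

/-- The function `log⁻ r = max (-log r) 0` with values in `[0, ∞]`, infinite at `r = 0`. -/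
def negLog (r : ℝ) : ℝ≥0∞ := if r = 0 then ∞ else ENNReal.ofReal (-Real.log r)

theorem measurable_negLog : Measurable negLog :=
  Measurable.ite (measurableSet_singleton 0) measurable_const
    Real.measurable_log.neg.ennreal_ofReal

theorem logIntegrableOn_of_lintegral_negLog_ne_top {f : ℝ → ℂ} {J : Set ℝ}
    (hf : IntegrableOn f J) (h : ∫⁻ x in J, negLog ‖f x‖ ≠ ∞) : LogIntegrableOn f J := by
  have hm : AEMeasurable (fun x => negLog ‖f x‖) (volume.restrict J) :=
    measurable_negLog.comp_aemeasurable hf.aestronglyMeasurable.norm.aemeasurable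
  have hne : ∀ᵐ t ∂volume.restrict J, f t ≠ 0 := by
    filter_upwards [ae_lt_top' hm h] with t ht h0
    simp [negLog, h0] at ht
  refine ⟨hne, ?_⟩
  have hi : Integrable (fun x => ‖f x‖ + (negLog ‖f x‖).toReal) (volume.restrict J) :=
    hf.norm.add (integrable_toReal_of_lintegral_ne_top hm h)
  refine hi.mono'
    (Real.measurable_log.comp_aemeasurable hf.aestronglyMeasurable.norm.aemeasurable
      ).aestronglyMeasurable ?_
  filter_upwards [hne] with t ht
  have hpos : 0 < ‖f t‖ := norm_pos_iff.2 ht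
  have h1 : (negLog ‖f t‖).toReal = max (-Real.log ‖f t‖) 0 := by
    rw [negLog, if_neg hpos.ne', ENNReal.toReal_ofReal']
  rw [h1, Real.norm_eq_abs, abs_le]
  have h2 := Real.log_le_self hpos.le
  have h3 := le_max_left (-Real.log ‖f t‖) 0
  have h4 := le_max_right (-Real.log ‖f t‖) 0
  constructor <;> linarith

/-- If `log⁻ |f|` has infinite integral over the interval, it dominates there an upper
semicontinuous function of arbitrary prescribed mean value. -/
theorem exists_upperSemicontinuous_le_negLog {f : ℝ → ℂ} (hf : AEStronglyMeasurable f) {u v : ℝ}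
    (h : ∫⁻ x in Ioo u v, negLog ‖f x‖ = ∞) {I : ℝ} (hI : 0 ≤ I) :
    ∃ (p : ℝ → ℝ) (S : ℝ), UpperSemicontinuous p ∧ (∀ x, 0 ≤ p x) ∧ (∀ x, p x ≤ S) ∧
      (∀ x, ENNReal.ofReal (p x) ≤ negLog ‖f x‖) ∧ ∫ x in Ioo u v, p x = I := by
  have hm : AEMeasurable (fun x => negLog ‖f x‖) (volume.restrict (Ioo u v)) :=
    measurable_negLog.comp_aemeasurable hf.norm.aemeasurable.restrict
  have hmct : Tendsto (fun N : ℕ => ∫⁻ x in Ioo u v, min (N : ℝ≥0∞) (negLog ‖f x‖)) atTop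
      (𝓝 (∫⁻ x in Ioo u v, negLog ‖f x‖)) := by
    refine lintegral_tendsto_of_tendsto_of_monotone (fun N => aemeasurable_const.min hm)
      (Eventually.of_forall fun x N N' hN => ?_) (Eventually.of_forall fun x => ?_)
    · exact min_le_min_right _ (by exact_mod_cast hN)
    · have := (ENNReal.tendsto_nat_nhds_top).min
        (tendsto_const_nhds (x := negLog ‖f x‖))
      simpa using this
  rw [h] at hmct
  obtain ⟨N, hN⟩ := ((tendsto_order.1 hmct).1 (ENNReal.ofReal I) ENNReal.ofReal_lt_top).exists
  set q : ℝ → ℝ≥0 := fun x => (min (N : ℝ≥0∞) (negLog ‖f x‖)).toNNReal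
  have hq (x : ℝ) : (q x : ℝ≥0∞) = min (N : ℝ≥0∞) (negLog ‖f x‖) :=
    ENNReal.coe_toNNReal (ne_top_of_le_ne_top (ENNReal.natCast_ne_top N) (min_le_left _ _))
  simp_rw [← hq] at hN
  have hfin : ∫⁻ x in Ioo u v, (q x : ℝ≥0∞) ≠ ∞ := by
    refine ne_top_of_le_ne_top ?_ (lintegral_mono (g := fun _ => (N : ℝ≥0∞)) fun x => ?_)
    · rw [setLIntegral_const, Real.volume_Ioo]
      exact ENNReal.mul_ne_top (ENNReal.natCast_ne_top N) ENNReal.ofReal_ne_top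
    · rw [hq]
      exact min_le_left _ _
  obtain ⟨ε, hε, hεN⟩ := ENNReal.lt_iff_exists_add_pos_lt.1 hN
  obtain ⟨p, hpq, hpu, hpI⟩ := exists_upperSemicontinuous_le_lintegral_le q hfin
    (ENNReal.coe_ne_zero.2 hε.ne')
  have hpI' : ENNReal.ofReal I < ∫⁻ x in Ioo u v, (p x : ℝ≥0∞) :=
    lt_of_add_lt_add_right (hεN.trans_le hpI)
  have hpfin : ∫⁻ x in Ioo u v, (p x : ℝ≥0∞) ≠ ∞ :=
    ne_top_of_le_ne_top hfin (lintegral_mono fun x => ENNReal.coe_le_coe.2 (hpq x))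
  set P : ℝ := ∫ x in Ioo u v, (p x : ℝ)
  have hP : P = (∫⁻ x in Ioo u v, (p x : ℝ≥0∞)).toReal := by
    rw [← integral_toReal hpu.measurable.coe_nnreal_ennreal.aemeasurable
      (Eventually.of_forall fun x => ENNReal.coe_lt_top)]
    simp [P]
  have hIP : I < P := by
    rw [hP]
    exact (ENNReal.ofReal_lt_iff_lt_toReal hI hpfin).1 hpI'
  have hP0 : 0 < P := hI.trans_lt hIP
  -- Rescaling by `I / P < 1` gives the exact mean value and preserves the pointwise bound.
  have hθ0 : 0 ≤ I / P := div_nonneg hI hP0.le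
  have hθ1 : I / P ≤ 1 := ((div_lt_one hP0).2 hIP).le
  have hle (x : ℝ) : I / P * p x ≤ p x := mul_le_of_le_one_left (p x).2 hθ1
  have hqx (x : ℝ) : (p x : ℝ≥0∞) ≤ min (N : ℝ≥0∞) (negLog ‖f x‖) := by
    rw [← hq]
    exact ENNReal.coe_le_coe.2 (hpq x)
  refine ⟨fun x => I / P * p x, N, ?_, fun x => mul_nonneg hθ0 (p x).2, fun x => ?_, fun x => ?_, ?_⟩
  · refine Continuous.comp_upperSemicontinuous (g := fun r : ℝ≥0 => I / P * (r : ℝ)) (by fun_prop)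
      hpu fun r r' hr => ?_
    exact mul_le_mul_of_nonneg_left (NNReal.coe_le_coe.2 hr) hθ0
  · refine (hle x).trans ?_
    have := (hqx x).trans (min_le_left _ _)
    exact_mod_cast this
  · calc ENNReal.ofReal (I / P * p x) ≤ ENNReal.ofReal (p x) := ENNReal.ofReal_le_ofReal (hle x)
      _ = p x := ENNReal.ofReal_coe_nnreal
      _ ≤ _ := (hqx x).trans (min_le_right _ _)
  · rw [integral_const_mul]
    exact div_mul_cancel₀ I hP0.ne'

/-- A real weight `τ` supported in the interval `(u, v)`, with zero mean and small total variation,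
such that multiplying `f` by `exp τ` makes it small on `(u, v)`. The negative part of `τ` is the
constant `M`; the compensating positive mass sits where `|f|` is small. -/
structure IsBalancedWeight (f : ℝ → ℂ) (M u v : ℝ) (τ : ℝ → ℝ) : Prop where
  measurable : Measurable τ
  bounded : ∃ S, ∀ t, |τ t| ≤ S
  eq_zero : ∀ t, t ∉ Ioo u v → τ t = 0
  integral_eq_zero : ∫ t, τ t = 0
  integral_abs_le : ∫ t, |τ t| ≤ 2 * M * (v - u)
  upperSemicontinuousAt : ∀ t, t ≠ u → t ≠ v → UpperSemicontinuousAt τ t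
  exp_mul_le : ∀ t ∈ Ioo u v, Real.exp (τ t) * ‖f t‖ ≤ Real.exp (-M) * max 1 ‖f t‖

theorem exists_isBalancedWeight {f : ℝ → ℂ} (hf : AEStronglyMeasurable f) {u v : ℝ} (huv : u ≤ v)
    (h : ∫⁻ x in Ioo u v, negLog ‖f x‖ = ∞) {M : ℝ} (hM : 0 ≤ M) :
    ∃ τ, IsBalancedWeight f M u v τ := by
  obtain ⟨p, S, hpu, hp0, hpS, hpf, hpI⟩ :=
    exists_upperSemicontinuous_le_negLog hf h (I := M * (v - u)) (mul_nonneg hM (sub_nonneg.2 huv))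
  have hvol : volume.real (Ioo u v) = v - u := by
    rw [Real.volume_real_Ioo_of_le huv]
  have hpi : IntegrableOn p (Ioo u v) := by
    refine Measure.integrableOn_of_bounded (M := S) (by simp)
      hpu.measurable.aestronglyMeasurable (Eventually.of_forall fun x => ?_)
    rw [Real.norm_of_nonneg (hp0 x)]
    exact hpS x
  have hci : IntegrableOn (fun _ : ℝ => M) (Ioo u v) := integrableOn_const (by simp)
  set τ : ℝ → ℝ := (Ioo u v).indicator fun x => p x - M
  have hτ_in {t : ℝ} (ht : t ∈ Ioo u v) : τ t = p t - M := indicator_of_mem ht _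
  have hτ_out {t : ℝ} (ht : t ∉ Ioo u v) : τ t = 0 := indicator_of_notMem ht _
  refine ⟨τ, ⟨(hpu.measurable.sub_const M).indicator measurableSet_Ioo, ⟨S + M, fun t => ?_⟩,
    fun t ht => hτ_out ht, ?_, ?_, fun t htu htv => ?_, fun t ht => ?_⟩⟩
  · have h1 := hp0 t
    have h2 := hpS t
    by_cases ht : t ∈ Ioo u v
    · rw [hτ_in ht, abs_le]
      constructor <;> linarith
    · rw [hτ_out ht, abs_zero]
      linarith
  · rw [integral_indicator measurableSet_Ioo, integral_sub hpi hci, hpI, setIntegral_const, hvol]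
    simp only [smul_eq_mul]
    ring
  · have h1 (t : ℝ) : |τ t| = (Ioo u v).indicator (fun x => |p x - M|) t := by
      by_cases ht : t ∈ Ioo u v
      · rw [hτ_in ht, indicator_of_mem ht]
      · rw [hτ_out ht, indicator_of_notMem ht, abs_zero]
    simp_rw [h1]
    rw [integral_indicator measurableSet_Ioo]
    calc _ ≤ ∫ x in Ioo u v, (p x + M) := by
          refine integral_mono (hpi.sub hci).abs (hpi.add hci) fun x => ?_
          have := hp0 x
          exact abs_le.2 ⟨by simp only; linarith, by simp only; linarith⟩
      _ = _ := by
          rw [integral_add hpi hci, hpI, setIntegral_const, hvol]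
          simp only [smul_eq_mul]
          ring
  · by_cases ht : t ∈ Ioo u v
    · intro y hy
      rw [hτ_in ht, sub_lt_iff_lt_add] at hy
      filter_upwards [hpu t _ hy, isOpen_Ioo.mem_nhds ht] with x hx hxm
      rw [hτ_in hxm]
      linarith
    · intro y hy
      have hcl : t ∈ (Icc u v)ᶜ := fun hmem =>
        ht ⟨lt_of_le_of_ne hmem.1 htu.symm, lt_of_le_of_ne hmem.2 htv⟩
      filter_upwards [isClosed_Icc.isOpen_compl.mem_nhds hcl] with x hx
      rw [hτ_out ht] at hy
      rwa [hτ_out fun hmem => hx (Ioo_subset_Icc_self hmem)]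
  · rw [hτ_in ht, sub_eq_add_neg, add_comm, Real.exp_add, mul_assoc]
    refine mul_le_mul_of_nonneg_left ?_ (Real.exp_pos _).le
    rcases eq_or_ne (f t) 0 with h0 | h0
    · simp [h0]
    have hpos : 0 < ‖f t‖ := norm_pos_iff.2 h0
    have h1 := hpf t
    rw [negLog, if_neg hpos.ne'] at h1
    rcases le_or_gt (-Real.log ‖f t‖) 0 with h2 | h2
    · have h3 : p t ≤ 0 := by
        rw [ENNReal.ofReal_of_nonpos h2] at h1
        exact ENNReal.ofReal_eq_zero.1 (le_antisymm h1 zero_le)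
      rw [le_antisymm h3 (hp0 t), Real.exp_zero, one_mul]
      exact le_max_right _ _
    · have h3 : p t ≤ -Real.log ‖f t‖ := (ENNReal.ofReal_le_ofReal_iff h2.le).1 h1
      refine le_trans ?_ (le_max_left _ _)
      calc Real.exp (p t) * ‖f t‖ ≤ Real.exp (-Real.log ‖f t‖) * ‖f t‖ := by gcongr
        _ = 1 := by rw [Real.exp_neg, Real.exp_log hpos, inv_mul_cancel₀ hpos.ne']

theorem norm_integral_mul_le_of_integral_eq_zero {τ : ℝ → ℝ} (hτ : Integrable τ)
    (h0 : ∫ t, τ t = 0) {u v : ℝ} (hsupp : ∀ t, t ∉ Ioo u v → τ t = 0) {φ : ℝ → ℂ}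
    (hφ : Continuous φ) {R : ℝ} (hR : ∀ t, ‖φ t‖ ≤ R) {η : ℝ} (t₀ : ℝ)
    (hη : ∀ t ∈ Ioo u v, ‖φ t - φ t₀‖ ≤ η) :
    ‖∫ t, (τ t : ℂ) * φ t‖ ≤ η * ∫ t, |τ t| := by
  have hτc : Integrable fun t => (τ t : ℂ) := hτ.ofReal
  have hi : Integrable fun t => (τ t : ℂ) * φ t :=
    hτc.mul_bdd (c := R) hφ.aestronglyMeasurable (Eventually.of_forall hR)
  have h1 : ∫ t, (τ t : ℂ) * φ t = ∫ t, (τ t : ℂ) * (φ t - φ t₀) := by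
    have h2 : ∫ t, (τ t : ℂ) * φ t₀ = 0 := by
      rw [integral_mul_const, integral_complex_ofReal, h0, Complex.ofReal_zero, zero_mul]
    simp_rw [mul_sub]
    rw [integral_sub hi (hτc.mul_const _), h2, sub_zero]
  rw [h1, ← integral_const_mul]
  refine norm_integral_le_of_norm_le (hτ.abs.const_mul η) (Eventually.of_forall fun t => ?_)
  rw [norm_mul, Complex.norm_real, Real.norm_eq_abs, mul_comm]
  by_cases ht : t ∈ Ioo u v
  · exact mul_le_mul_of_nonneg_right (hη t ht) (abs_nonneg _)
  · simp [hsupp t ht]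

/-- A weight `σ` supported in an open set `B ⊆ (a, b)` covering almost all of `E ∩ (a, b)` and
contained in the `h`-neighbourhood of `E`, such that `σ` has zero mean at scale `h` and multiplying
`f` by `exp σ` makes it small on `B`. The field `cancel` encodes the zero mean at scale `h`. -/
structure IsLocalizedWeight (f : ℝ → ℂ) (E : Set ℝ) (M a b h : ℝ) (σ : ℝ → ℝ) (B : Set ℝ) :
    Prop where
  measurable : Measurable σ
  bounded : ∃ S, ∀ t, |σ t| ≤ S
  eq_zero : ∀ t, t ∉ B → σ t = 0
  integral_abs_le : ∫ t, |σ t| ≤ 2 * M * (b - a)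
  upperSemicontinuousAt : ∀ᵐ t, UpperSemicontinuousAt σ t
  exp_mul_le : ∀ t ∈ B, Real.exp (σ t) * ‖f t‖ ≤ Real.exp (-M) * max 1 ‖f t‖
  isOpen : IsOpen B
  subset : B ⊆ Ioo a b
  ae_mem : ∀ᵐ t, t ∈ Ioo a b ∩ E → t ∈ B
  exists_near : ∀ t ∈ B, ∃ e ∈ E ∩ Icc a b, |t - e| ≤ h
  cancel : ∀ (φ : ℝ → ℂ) (R η : ℝ), Continuous φ → (∀ t, ‖φ t‖ ≤ R) → 0 ≤ η →
    (∀ t t₀ : ℝ, |t - t₀| ≤ h → (∃ e ∈ E ∩ Icc a b, |t - e| ≤ h) →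
      (∃ e ∈ E ∩ Icc a b, |t₀ - e| ≤ h) → ‖φ t - φ t₀‖ ≤ η) →
    ‖∫ t, (σ t : ℂ) * φ t‖ ≤ η * (2 * M * (b - a))

theorem integrable_of_abs_le_of_eq_zero {σ : ℝ → ℝ} (hσ : Measurable σ) {S a b : ℝ}
    (hS : ∀ t, |σ t| ≤ S) (h0 : ∀ t, t ∉ Ioo a b → σ t = 0) : Integrable σ := by
  have h1 : IntegrableOn σ (Ioo a b) :=
    Measure.integrableOn_of_bounded (M := S) (by simp) hσ.aestronglyMeasurable
      (Eventually.of_forall hS)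
  exact h1.integrable_of_forall_notMem_eq_zero h0

theorem IsLocalizedWeight.integrable {f : ℝ → ℂ} {E : Set ℝ} {M a b h : ℝ} {σ : ℝ → ℝ}
    {B : Set ℝ} (H : IsLocalizedWeight f E M a b h σ B) : Integrable σ := by
  obtain ⟨S, hS⟩ := H.bounded
  exact integrable_of_abs_le_of_eq_zero H.measurable hS
    fun t ht => H.eq_zero t fun hB => ht (H.subset hB)

/-- The localized weight at scale `(b - a) / N` is a sum of balanced weights over those of the `N`
equal subintervals of `(a, b)` that meet `E`. -/
theorem exists_isLocalizedWeight {f : ℝ → ℂ} (hf : AEStronglyMeasurable f) {E : Set ℝ}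
    (hE : ∀ u v, (Ioo u v ∩ E).Nonempty → ∫⁻ x in Ioo u v, negLog ‖f x‖ = ∞) {M a b : ℝ}
    (hM : 0 ≤ M) (hab : a ≤ b) {N : ℕ} (hN : 0 < N) :
    ∃ σ B, IsLocalizedWeight f E M a b ((b - a) / N) σ B := by
  classical
  have hex (u v : ℝ) : ∃ τ : ℝ → ℝ, (Ioo u v ∩ E).Nonempty → IsBalancedWeight f M u v τ := by
    by_cases hne : (Ioo u v ∩ E).Nonempty
    · obtain ⟨x, hx, -⟩ := id hne
      obtain ⟨τ, hτ⟩ := exists_isBalancedWeight hf (hx.1.trans hx.2).le (hE u v hne) hM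
      exact ⟨τ, fun _ => hτ⟩
    · exact ⟨0, fun hh => absurd hh hne⟩
  choose T hT using hex
  have hN0 : (0 : ℝ) < N := Nat.cast_pos.2 hN
  set h : ℝ := (b - a) / N
  have hh : 0 ≤ h := div_nonneg (sub_nonneg.2 hab) hN0.le
  have hhN : N * h = b - a := mul_div_cancel₀ _ hN0.ne'
  set p : ℕ → ℝ := fun i => a + i * h
  have hp (i : ℕ) : p (i + 1) = p i + h := by simp only [p]; push_cast; ring
  have hpmono : Monotone p := monotone_nat_of_le_succ fun i => by rw [hp]; linarith
  have hp0 : p 0 = a := by simp [p]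
  have hpN : p N = b := by simp only [p]; linarith
  set I : ℕ → Set ℝ := fun i => Ioo (p i) (p (i + 1))
  have hIdisj {i j : ℕ} {t : ℝ} (hi : t ∈ I i) (hj : t ∈ I j) : i = j := by
    by_contra hne
    rcases Nat.lt_or_gt_of_ne hne with hlt | hlt
    · linarith [hi.2, hj.1, hpmono (Nat.succ_le_of_lt hlt)]
    · linarith [hj.2, hi.1, hpmono (Nat.succ_le_of_lt hlt)]
  set bad : Finset ℕ := (Finset.range N).filter fun i => (I i ∩ E).Nonempty
  have hbad {i : ℕ} (hi : i ∈ bad) : i < N ∧ (I i ∩ E).Nonempty := by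
    simpa [bad] using hi
  set τ : ℕ → ℝ → ℝ := fun i => T (p i) (p (i + 1))
  have hτ {i : ℕ} (hi : i ∈ bad) : IsBalancedWeight f M (p i) (p (i + 1)) (τ i) :=
    hT _ _ (hbad hi).2
  have hτi {i : ℕ} (hi : i ∈ bad) : Integrable (τ i) := by
    obtain ⟨S, hS⟩ := (hτ hi).bounded
    exact integrable_of_abs_le_of_eq_zero (hτ hi).measurable hS (hτ hi).eq_zero
  have hIsub {i : ℕ} (hi : i < N) : I i ⊆ Ioo a b := fun t ht =>
    ⟨(hp0 ▸ hpmono (Nat.zero_le i)).trans_lt ht.1, ht.2.trans_le (hpN ▸ hpmono hi)⟩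
  have hnear {i : ℕ} (hi : i ∈ bad) {t : ℝ} (ht : t ∈ Icc (p i) (p (i + 1))) :
      ∃ e ∈ E ∩ Icc a b, |t - e| ≤ h := by
    obtain ⟨hiN, e, he, heE⟩ := hbad hi
    refine ⟨e, ⟨heE, Ioo_subset_Icc_self (hIsub hiN he)⟩, ?_⟩
    have h1 := ht.1
    have h2 := ht.2
    have h3 := he.1
    have h4 := he.2
    rw [hp] at h2 h4
    exact abs_le.2 ⟨by linarith, by linarith⟩
  set σ : ℝ → ℝ := fun t => ∑ i ∈ bad, τ i t
  set B : Set ℝ := ⋃ i ∈ bad, I i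
  have hσ_in {i : ℕ} (hi : i ∈ bad) {t : ℝ} (ht : t ∈ I i) : σ t = τ i t :=
    Finset.sum_eq_single i (fun j hj hji => (hτ hj).eq_zero t fun hjt => hji (hIdisj hjt ht))
      fun hni => absurd hi hni
  have hsumle : ∑ i ∈ bad, ∫ t, |τ i t| ≤ 2 * M * (b - a) := by
    calc _ ≤ ∑ i ∈ bad, 2 * M * h := Finset.sum_le_sum fun i hi => by
            refine ((hτ hi).integral_abs_le).trans_eq ?_
            rw [hp]
            ring
      _ ≤ ∑ i ∈ Finset.range N, 2 * M * h :=
          Finset.sum_le_sum_of_subset_of_nonneg (Finset.filter_subset _ _)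
            fun _ _ _ => by positivity
      _ = _ := by
          rw [Finset.sum_const, Finset.card_range, nsmul_eq_mul, ← hhN]
          ring
  have hgrid : ∀ᵐ t : ℝ, ∀ i, t ≠ p i := ae_all_iff.2 fun i => by
    simp [ae_iff]
  refine ⟨σ, B, ⟨?_, ?_, fun t ht => ?_, ?_, ?_, fun t ht => ?_, ?_, ?_, ?_, fun t ht => ?_, ?_⟩⟩
  · exact Finset.measurable_fun_sum _ fun i hi => (hτ hi).measurable
  · have hex (i : ℕ) : ∃ S, i ∈ bad → ∀ t, |τ i t| ≤ S := by
      by_cases hi : i ∈ bad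
      · exact (hτ hi).bounded.imp fun S hS _ => hS
      · exact ⟨0, fun h => absurd h hi⟩
    choose S hS using hex
    exact ⟨∑ i ∈ bad, S i, fun t => (Finset.abs_sum_le_sum_abs _ _).trans
      (Finset.sum_le_sum fun i hi => hS i hi t)⟩
  · refine Finset.sum_eq_zero fun i hi => (hτ hi).eq_zero t fun hit => ht ?_
    exact mem_biUnion hi hit
  · refine le_trans ?_ hsumle
    rw [← integral_finsetSum _ fun i hi => (hτi hi).abs]
    exact integral_mono (integrable_finsetSum _ fun i hi => hτi hi).abs
      (integrable_finsetSum _ fun i hi => (hτi hi).abs) fun t => Finset.abs_sum_le_sum_abs _ _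
  · filter_upwards [hgrid] with t ht
    exact upperSemicontinuousAt_sum fun i hi =>
      (hτ hi).upperSemicontinuousAt t (ht i) (ht (i + 1))
  · obtain ⟨i, hi, hit⟩ := mem_iUnion₂.1 ht
    rw [hσ_in hi hit]
    exact (hτ hi).exp_mul_le t hit
  · exact isOpen_biUnion fun i _ => isOpen_Ioo
  · exact iUnion₂_subset fun i hi => hIsub (hbad hi).1
  · filter_upwards [hgrid] with t ht htE
    -- The index of the subinterval containing `t` is the least one whose right end exceeds `t`.
    have hlast : ∃ i, t < p (i + 1) := by
      refine ⟨N - 1, ?_⟩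
      rw [Nat.sub_add_cancel hN, hpN]
      exact htE.1.2
    set i := Nat.find hlast
    have hi : t < p (i + 1) := Nat.find_spec hlast
    have hi' : p i < t := by
      rcases Nat.eq_zero_or_pos i with h0 | h0
      · rw [h0, hp0]
        exact htE.1.1
      · have h1 : ¬ t < p (i - 1 + 1) := Nat.find_min hlast (Nat.sub_lt h0 one_pos)
        rw [Nat.sub_add_cancel h0] at h1
        exact lt_of_le_of_ne (not_lt.1 h1) (ht i).symm
    have hiN : i < N := by
      by_contra hge
      have := hpmono (not_lt.1 hge)
      rw [hpN] at this
      linarith [htE.1.2]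
    refine mem_biUnion (Finset.mem_coe.2 (Finset.mem_filter.2 ⟨Finset.mem_range.2 hiN, ?_⟩))
      (show t ∈ I i from ⟨hi', hi⟩)
    exact ⟨t, ⟨hi', hi⟩, htE.2⟩
  · obtain ⟨i, hi, hit⟩ := mem_iUnion₂.1 ht
    exact hnear hi (Ioo_subset_Icc_self hit)
  · intro φ R η hφ hR hη hosc
    have hi {i : ℕ} (hi : i ∈ bad) : Integrable fun t => (τ i t : ℂ) * φ t := by
      have hc : Integrable fun t => (τ i t : ℂ) := (hτi hi).ofReal
      exact hc.mul_bdd (c := R) hφ.aestronglyMeasurable (Eventually.of_forall hR)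
    have h1 : ∫ t, (σ t : ℂ) * φ t = ∑ i ∈ bad, ∫ t, (τ i t : ℂ) * φ t := by
      rw [← integral_finsetSum _ fun i => hi]
      refine integral_congr_ae (Eventually.of_forall fun t => ?_)
      simp only [σ]
      push_cast
      rw [Finset.sum_mul]
    rw [h1]
    calc _ ≤ ∑ i ∈ bad, ‖∫ t, (τ i t : ℂ) * φ t‖ := norm_sum_le _ _
      _ ≤ ∑ i ∈ bad, η * ∫ t, |τ i t| := Finset.sum_le_sum fun i hi => by
          refine norm_integral_mul_le_of_integral_eq_zero (hτi hi) (hτ hi).integral_eq_zero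
            (hτ hi).eq_zero hφ hR (p i) fun t ht => hosc t (p i) ?_
              (hnear hi (Ioo_subset_Icc_self ht)) (hnear hi ⟨le_rfl, hpmono (Nat.le_succ i)⟩)
          have h2 := ht.1
          have h3 := ht.2
          rw [hp] at h3
          exact abs_le.2 ⟨by linarith, by linarith⟩
      _ ≤ η * (2 * M * (b - a)) := by
          rw [← Finset.mul_sum]
          exact mul_le_mul_of_nonneg_left hsumle hη

theorem IsLocalizedWeight.norm_cauchyDensity_le_mul {f : ℝ → ℂ} {E : Set ℝ} {M a b h : ℝ}
    {σ : ℝ → ℝ} {B : Set ℝ} (H : IsLocalizedWeight f E M a b h σ B) (hh : 0 ≤ h) {δ s : ℝ}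
    (hδ : 0 ≤ δ) (hs : 0 ≤ s) :
    ‖cauchyDensity σ δ s‖ ≤ Real.pi⁻¹ * (s * h * (2 * M * (b - a))) := by
  have h1 := H.cancel (fun t => Complex.exp (Complex.I * s * t)) 1 (s * h) (by fun_prop)
    (fun t => (norm_exp_I_mul s t).le) (by positivity) fun t t₀ htt _ _ => by
      have h2 : Complex.exp (Complex.I * s * t) - Complex.exp (Complex.I * s * t₀) =
          Complex.exp (Complex.I * s * t₀) *
            (Complex.exp (Complex.I * (s * (t - t₀) : ℝ)) - 1) := by
        rw [mul_sub, ← Complex.exp_add, mul_one]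
        congr 2
        push_cast
        ring
      rw [h2, norm_mul, norm_exp_I_mul, one_mul]
      refine (Real.norm_exp_I_mul_ofReal_sub_one_le).trans ?_
      rw [norm_mul, Real.norm_of_nonneg hs, Real.norm_eq_abs]
      gcongr
  rw [cauchyDensity, norm_mul, Complex.norm_real, Real.norm_of_nonneg (by positivity)]
  refine mul_le_mul (mul_le_of_le_one_right (by positivity) (Real.exp_le_one_iff.2 ?_)) h1
    (norm_nonneg _) (by positivity)
  nlinarith

/-- Far from `E` the Cauchy integral of a localized weight is small, by cancellation. -/
theorem IsLocalizedWeight.norm_halfLineFourier_cauchyDensity_le {f : ℝ → ℂ} {E : Set ℝ}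
    {M a b h : ℝ} {σ : ℝ → ℝ} {B : Set ℝ} (H : IsLocalizedWeight f E M a b h σ B) (hh : 0 ≤ h)
    {δ : ℝ} (hδ : 0 < δ) {d x : ℝ} (hd : 0 < d)
    (hx : ∀ t : ℝ, (∃ e ∈ E ∩ Icc a b, |t - e| ≤ h) → d ≤ |x - t|) :
    ‖halfLineFourier (cauchyDensity σ δ) x‖ ≤ Real.pi⁻¹ * (h / d ^ 2 * (2 * M * (b - a))) := by
  have hre (t : ℝ) : ((δ : ℂ) + Complex.I * (x - t)).re = δ := by simp
  have him (t : ℝ) : ((δ : ℂ) + Complex.I * (x - t)).im = x - t := by simp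
  have hne (t : ℝ) : (δ : ℂ) + Complex.I * (x - t) ≠ 0 := fun h0 => by
    have := congrArg Complex.re h0
    rw [hre] at this
    exact hδ.ne' this
  have hnorm (t : ℝ) (ht : ∃ e ∈ E ∩ Icc a b, |t - e| ≤ h) :
      d ≤ ‖(δ : ℂ) + Complex.I * (x - t)‖ := by
    have := Complex.abs_im_le_norm ((δ : ℂ) + Complex.I * (x - t))
    rw [him] at this
    exact (hx t ht).trans this
  have h1 := H.cancel (fun t => ((δ : ℂ) + Complex.I * (x - t))⁻¹) δ⁻¹ (h / d ^ 2)
    (Continuous.inv₀ (by fun_prop) hne) (fun t => by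
      rw [norm_inv]
      refine inv_anti₀ hδ ?_
      have := Complex.abs_re_le_norm ((δ : ℂ) + Complex.I * (x - t))
      rwa [hre, abs_of_pos hδ] at this) (by positivity) fun t t₀ htt ht ht₀ => by
      rw [inv_sub_inv (hne t) (hne t₀), norm_div, norm_mul]
      have h2 : (δ : ℂ) + Complex.I * (x - t₀) - (δ + Complex.I * (x - t)) =
          Complex.I * ((t - t₀ : ℝ) : ℂ) := by
        push_cast
        ring
      rw [h2, norm_mul, Complex.norm_I, one_mul, Complex.norm_real, Real.norm_eq_abs, sq]
      have h3 := hnorm t ht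
      have h4 := hnorm t₀ ht₀
      gcongr
  rw [halfLineFourier_cauchyDensity H.integrable hδ, norm_mul, Complex.norm_real,
    Real.norm_of_nonneg (by positivity)]
  exact mul_le_mul_of_nonneg_left h1 (by positivity)

/-! ### Vanishing on the set where the logarithmic integral diverges locally -/

/-- If `|k|` exceeds `exp σ` only slightly in mean, then `F k` is of size `exp (-M)` on `B`; so the
integral of `F` over `B` is controlled by that of `F (k - 1)` over the line and by the deviation of
`k` from `1` off `B`. -/
theorem IsLocalizedWeight.norm_setIntegral_le {f F : ℝ → ℂ} {w : ℝ → ℝ} (hF : Integrable F)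
    (hw : Integrable w) (hw0 : ∀ x, 0 ≤ w x) (hFw : ∀ x, ‖F x‖ = ‖f x‖ * w x) {E : Set ℝ}
    {M a b h : ℝ} {σ : ℝ → ℝ} {B : Set ℝ} (H : IsLocalizedWeight f E M a b h σ B) {k : ℝ → ℂ}
    (hk : Continuous k) {Q : ℝ} (hkQ : ∀ x, ‖k x‖ ≤ Q) {ε : ℝ}
    (hε : ∫ x, ‖F x‖ * max 0 (‖k x‖ - Real.exp (σ x)) ≤ ε) :
    ‖∫ x in B, F x‖ ≤ ‖∫ x, F x * (k x - 1)‖ +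
      Real.exp (-M) * (∫ x in Ioo a b, (‖F x‖ + w x)) +
      (∫ x, ‖F x‖ * Bᶜ.indicator (fun x => min 2 ‖k x - 1‖) x) + ε := by
  obtain ⟨S, hS⟩ := H.bounded
  have hBm : MeasurableSet B := H.isOpen.measurableSet
  have hkF : Integrable fun x => F x * k x :=
    hF.mul_bdd (c := Q) hk.aestronglyMeasurable (Eventually.of_forall hkQ)
  have hkF1 : Integrable fun x => F x * (k x - 1) := by
    simp_rw [mul_sub, mul_one]
    exact hkF.sub hF
  have hQ : 0 ≤ Q := (norm_nonneg _).trans (hkQ 0)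
  have hexc : Integrable fun x => ‖F x‖ * max 0 (‖k x‖ - Real.exp (σ x)) := by
    refine hF.norm.mul_bdd (c := Q) ?_ (Eventually.of_forall fun x => ?_)
    · exact (measurable_const.max
        (hk.norm.measurable.sub (Real.measurable_exp.comp H.measurable))).aestronglyMeasurable
    · rw [Real.norm_of_nonneg (le_max_left _ _)]
      exact max_le hQ (by linarith [hkQ x, Real.exp_pos (σ x)])
  have htrunc : Integrable fun x => ‖F x‖ * Bᶜ.indicator (fun x => min 2 ‖k x - 1‖) x := by
    refine hF.norm.mul_bdd (c := 2) ?_ (Eventually.of_forall fun x => ?_)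
    · exact (Measurable.indicator (by fun_prop) hBm.compl).aestronglyMeasurable
    · refine (norm_indicator_le_norm_self _ _).trans ?_
      rw [Real.norm_of_nonneg (by positivity)]
      exact min_le_left _ _
  have hI : IntegrableOn (fun x => ‖F x‖ + w x) B := (hF.norm.add hw).integrableOn
  -- On `B` the outer function itself is small; off `B` it is compared with `1`.
  have hdecomp : ∫ x in B, F x =
      (∫ x, (B.indicator (fun x => F x * k x) x + Bᶜ.indicator (fun x => F x * (k x - 1)) x)) -
        ∫ x, F x * (k x - 1) := by
    have hi : Integrable fun x => B.indicator (fun x => F x * k x) x +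
        Bᶜ.indicator (fun x => F x * (k x - 1)) x :=
      (hkF.indicator hBm).add (hkF1.indicator hBm.compl)
    rw [← integral_sub hi hkF1, ← integral_indicator hBm]
    refine integral_congr_ae (Eventually.of_forall fun x => ?_)
    by_cases hx : x ∈ B
    · simp [hx]
      ring
    · simp [hx]
  have hpt (x : ℝ) :
      ‖B.indicator (fun x => F x * k x) x + Bᶜ.indicator (fun x => F x * (k x - 1)) x‖ ≤
        B.indicator (fun x => Real.exp (-M) * (‖F x‖ + w x)) x +
        ‖F x‖ * Bᶜ.indicator (fun x => min 2 ‖k x - 1‖) x +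
        ‖F x‖ * max 0 (‖k x‖ - Real.exp (σ x)) := by
    have hmax := le_max_right 0 (‖k x‖ - Real.exp (σ x))
    by_cases hx : x ∈ B
    · have h1 := H.exp_mul_le x hx
      have h2 : max 1 ‖f x‖ ≤ 1 + ‖f x‖ :=
        max_le (by linarith [norm_nonneg (f x)]) (by linarith)
      have h3 : ‖F x‖ * Real.exp (σ x) ≤ Real.exp (-M) * (‖F x‖ + w x) := by
        calc ‖F x‖ * Real.exp (σ x) = Real.exp (σ x) * ‖f x‖ * w x := by rw [hFw]; ring
          _ ≤ Real.exp (-M) * (1 + ‖f x‖) * w x :=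
            mul_le_mul_of_nonneg_right
              (h1.trans (mul_le_mul_of_nonneg_left h2 (Real.exp_pos _).le)) (hw0 x)
          _ = _ := by rw [hFw]; ring
      have h4 := mul_le_mul_of_nonneg_left hmax (norm_nonneg (F x))
      simp only [indicator_of_mem hx, indicator_of_notMem (notMem_compl_iff.2 hx), add_zero,
        mul_zero, norm_mul]
      linarith
    · have h1 : ‖k x - 1‖ ≤ min 2 ‖k x - 1‖ + max 0 (‖k x‖ - Real.exp (σ x)) := by
        rw [H.eq_zero x hx, Real.exp_zero] at hmax ⊢
        rcases le_total 2 ‖k x - 1‖ with h2 | h2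
        · rw [min_eq_left h2]
          have := norm_sub_le (k x) 1
          rw [norm_one] at this
          linarith
        · rw [min_eq_right h2]
          linarith [le_max_left 0 (‖k x‖ - 1)]
      simp only [indicator_of_notMem hx, indicator_of_mem (mem_compl hx), zero_add, norm_mul]
      rw [← mul_add]
      exact mul_le_mul_of_nonneg_left h1 (norm_nonneg _)
  have hBI : ∫ x, B.indicator (fun x => Real.exp (-M) * (‖F x‖ + w x)) x ≤
      Real.exp (-M) * ∫ x in Ioo a b, (‖F x‖ + w x) := by
    rw [integral_indicator hBm, integral_const_mul]
    refine mul_le_mul_of_nonneg_left ?_ (Real.exp_pos _).le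
    exact setIntegral_mono_set (hF.norm.add hw).integrableOn
      (Eventually.of_forall fun x => add_nonneg (norm_nonneg _) (hw0 x))
      (Eventually.of_forall H.subset)
  have hmain : ‖∫ x, (B.indicator (fun x => F x * k x) x +
      Bᶜ.indicator (fun x => F x * (k x - 1)) x)‖ ≤
      (∫ x, B.indicator (fun x => Real.exp (-M) * (‖F x‖ + w x)) x) +
        (∫ x, ‖F x‖ * Bᶜ.indicator (fun x => min 2 ‖k x - 1‖) x) +
        ∫ x, ‖F x‖ * max 0 (‖k x‖ - Real.exp (σ x)) := by
    have hi1 : Integrable (B.indicator fun x => Real.exp (-M) * (‖F x‖ + w x)) :=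
      IntegrableOn.integrable_indicator (hI.const_mul _) hBm
    have hi2 : Integrable fun x => B.indicator (fun x => Real.exp (-M) * (‖F x‖ + w x)) x +
        ‖F x‖ * Bᶜ.indicator (fun x => min 2 ‖k x - 1‖) x := hi1.add htrunc
    rw [← integral_add hi1 htrunc, ← integral_add hi2 hexc]
    exact norm_integral_le_of_norm_le (hi2.add hexc) (Eventually.of_forall hpt)
  rw [hdecomp]
  refine (norm_sub_le _ _).trans ?_
  linarith

theorem exists_forall_le_abs_sub_of_notMem {E₀ : Set ℝ} (hE₀ : IsClosed E₀) {x : ℝ} (hx : x ∉ E₀) :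
    ∃ d > 0, ∀ h ≤ d, ∀ t : ℝ, (∃ e ∈ E₀, |t - e| ≤ h) → d ≤ |x - t| := by
  obtain ⟨r, hr, hball⟩ := Metric.isOpen_iff.1 hE₀.isOpen_compl x hx
  refine ⟨r / 2, half_pos hr, fun h hh t ⟨e, he, hte⟩ => ?_⟩
  have h1 : r ≤ |x - e| := by
    by_contra hlt
    refine hball (Metric.mem_ball.2 ?_) he
    rw [Real.dist_eq, abs_sub_comm]
    exact not_le.1 hlt
  have h2 := abs_sub_le x t e
  linarith

/-- If the Fourier transform of `F = f ψ` is `O(exp (-c √s))` on the positive half-line, and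
`log⁻ |f|` has infinite integral over each interval that meets the closed set `E`, then the integral
of `F` over `E ∩ (a, b)` gains a factor `exp (-M)`, provided that `M (b - a)` is small compared
with `c ^ 2`. -/
theorem norm_setIntegral_inter_le_of_small {f F : ℝ → ℂ} (hf : AEStronglyMeasurable f) {w : ℝ → ℝ}
    (hF : Integrable F) (hw : Integrable w) (hw0 : ∀ x, 0 ≤ w x)
    (hFw : ∀ x, ‖F x‖ = ‖f x‖ * w x) {c C : ℝ} (hc : 0 < c) (hC : 0 ≤ C)
    (hFC : ∀ s : ℝ, 0 ≤ s → ‖∫ x : ℝ, F x * Complex.exp (-Complex.I * x * s)‖ ≤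
      C * Real.exp (-c * Real.sqrt s)) {E : Set ℝ} (hEc : IsClosed E)
    (hE : ∀ u v, (Ioo u v ∩ E).Nonempty → ∫⁻ x in Ioo u v, negLog ‖f x‖ = ∞) {M a b : ℝ}
    (hM : 0 ≤ M) (hab : a ≤ b) (hsmall : Real.pi⁻¹ * (2 * M * (b - a)) < c ^ 2 / 4) :
    ‖∫ x in Ioo a b ∩ E, F x‖ ≤ Real.exp (-M) * ∫ x in Ioo a b, (‖F x‖ + w x) := by
  set h : ℕ → ℝ := fun m => (b - a) / (m + 1 : ℕ)
  have hh0 (m : ℕ) : 0 ≤ h m := div_nonneg (sub_nonneg.2 hab) (Nat.cast_nonneg _)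
  have hh : Tendsto h atTop (𝓝 0) :=
    (tendsto_const_div_atTop_nhds_zero_nat (b - a)).comp (tendsto_add_atTop_nat 1)
  have hV : 0 ≤ 2 * M * (b - a) := mul_nonneg (by positivity) (sub_nonneg.2 hab)
  choose σ B H using fun m : ℕ => exists_isLocalizedWeight hf hE hM hab (Nat.succ_pos m)
  have hδex (m : ℕ) : ∃ δ > 0, ∫ x : ℝ, ‖F x‖ * max 0
      (‖Complex.exp (halfLineFourier (cauchyDensity (σ m) δ) x)‖ - Real.exp (σ m x)) ≤
        1 / ((m : ℝ) + 1) := by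
    obtain ⟨S, hS⟩ := (H m).bounded
    have h1 := (tendsto_order.1 (tendsto_integral_norm_mul_exp_halfLineFourier_excess hF
      (H m).integrable hS (H m).upperSemicontinuousAt)).2 (1 / ((m : ℝ) + 1)) (by positivity)
    obtain ⟨δ, h2, h3⟩ := (h1.and self_mem_nhdsWithin).exists
    exact ⟨δ, h3, h2.le⟩
  choose δ hδ hexc using hδex
  set κ : ℕ → ℝ → ℂ := fun m => cauchyDensity (σ m) (δ m)
  have hκ (m : ℕ) : IntegrableOn (κ m) (Ioi 0) := integrableOn_cauchyDensity (H m).integrable (hδ m)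
  set k : ℕ → ℝ → ℂ := fun m x => Complex.exp (halfLineFourier (κ m) x)
  have hkc (m : ℕ) : Continuous (k m) :=
    Complex.continuous_exp.comp (continuous_halfLineFourier (hκ m))
  have hkQ (m : ℕ) : ∃ Q, ∀ x, ‖k m x‖ ≤ Q := by
    obtain ⟨S, hS⟩ := (H m).bounded
    refine ⟨Real.exp S, fun x => ?_⟩
    rw [Complex.norm_exp]
    exact Real.exp_le_exp.2 (re_halfLineFourier_cauchyDensity_le (H m).integrable hS (hδ m) x)
  have hlim1 : Tendsto (fun m => ∫ x : ℝ, F x * (k m x - 1)) atTop (𝓝 0) := by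
    refine tendsto_integral_mul_exp_halfLineFourier_sub_one hF hκ hc hC
      (L := Real.pi⁻¹ * (2 * M * (b - a))) (by positivity) hsmall (fun m s hs => ?_)
      (fun s hs => ?_) hFC
    · exact (norm_cauchyDensity_le (σ m) (hδ m).le hs.le).trans
        (mul_le_mul_of_nonneg_left (H m).integral_abs_le (by positivity))
    · refine squeeze_zero_norm (fun m =>
        (H m).norm_cauchyDensity_le_mul (hh0 m) (hδ m).le hs.le) ?_
      have h1 : Tendsto (fun m => Real.pi⁻¹ * (s * h m * (2 * M * (b - a)))) atTop
          (𝓝 (Real.pi⁻¹ * (s * 0 * (2 * M * (b - a))))) :=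
        ((hh.const_mul s).mul_const _).const_mul _
      simp only [mul_zero, zero_mul] at h1
      exact h1
  have hE₀ : IsClosed (E ∩ Icc a b) := hEc.inter isClosed_Icc
  -- Away from `E ∩ [a, b]`, points eventually leave `B m` and `k m → 1`.
  have hfar {x : ℝ} (hx : x ∉ E ∩ Icc a b) :
      (∀ᶠ m in atTop, x ∉ B m) ∧ Tendsto (fun m => k m x) atTop (𝓝 1) := by
    obtain ⟨d, hd, hdx⟩ := exists_forall_le_abs_sub_of_notMem hE₀ hx
    have hev : ∀ᶠ m in atTop, h m ≤ d := ((tendsto_order.1 hh).2 d hd).mono fun m hm => hm.le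
    constructor
    · filter_upwards [hev] with m hm hxB
      have := hdx (h m) hm x ((H m).exists_near x hxB)
      rw [sub_self, abs_zero] at this
      linarith
    · have h1 : Tendsto (fun m => halfLineFourier (κ m) x) atTop (𝓝 0) := by
        refine squeeze_zero_norm' (a := fun m =>
          Real.pi⁻¹ * (h m / d ^ 2 * (2 * M * (b - a)))) ?_ ?_
        · filter_upwards [hev] with m hm
          exact (H m).norm_halfLineFourier_cauchyDensity_le (hh0 m) (hδ m) hd (hdx (h m) hm)
        · have h2 : Tendsto (fun m => Real.pi⁻¹ * (h m / d ^ 2 * (2 * M * (b - a)))) atTop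
              (𝓝 (Real.pi⁻¹ * (0 / d ^ 2 * (2 * M * (b - a))))) :=
            ((hh.div_const _).mul_const _).const_mul _
          simp only [zero_div, zero_mul, mul_zero] at h2
          exact h2
      have h2 := (Complex.continuous_exp.tendsto 0).comp h1
      rwa [Complex.exp_zero] at h2
  have hae : ∀ᵐ x : ℝ, (x ∈ Ioo a b ∩ E ∧ ∀ m, x ∈ B m) ∨
      (x ∉ Ioo a b ∩ E ∧ (∀ᶠ m in atTop, x ∉ B m) ∧ Tendsto (fun m => k m x) atTop (𝓝 1)) := by
    have ha : ∀ᵐ x : ℝ, x ≠ a := by simp [ae_iff]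
    have hb : ∀ᵐ x : ℝ, x ≠ b := by simp [ae_iff]
    filter_upwards [ae_all_iff.2 fun m => (H m).ae_mem, ha, hb] with x hx hxa hxb
    by_cases hxE : x ∈ Ioo a b ∩ E
    · exact Or.inl ⟨hxE, fun m => hx m hxE⟩
    · refine Or.inr ⟨hxE, hfar fun hx' => hxE ⟨⟨?_, ?_⟩, hx'.1⟩⟩
      · exact lt_of_le_of_ne hx'.2.1 hxa.symm
      · exact lt_of_le_of_ne hx'.2.2 hxb
  have hBm (m : ℕ) : MeasurableSet (B m) := (H m).isOpen.measurableSet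
  have hlim2 : Tendsto (fun m => ∫ x : ℝ, ‖F x‖ *
      (B m)ᶜ.indicator (fun x => min 2 ‖k m x - 1‖) x) atTop (𝓝 0) := by
    suffices h1 : Tendsto (fun m => ∫ x : ℝ, ‖F x‖ *
        (B m)ᶜ.indicator (fun x => min 2 ‖k m x - 1‖) x) atTop (𝓝 (∫ x : ℝ, ‖F x‖ * 0)) by
      simpa using h1
    have h2 (m : ℕ) (x : ℝ) : 0 ≤ (B m)ᶜ.indicator (fun x => min 2 ‖k m x - 1‖) x :=
      indicator_nonneg (fun x _ => by positivity) x
    have h3 (m : ℕ) (x : ℝ) : (B m)ᶜ.indicator (fun x => min 2 ‖k m x - 1‖) x ≤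
        min 2 ‖k m x - 1‖ := indicator_le_self' (fun x _ => by positivity) x
    refine tendsto_integral_of_dominated_convergence (fun x => ‖F x‖ * 2) (fun m => ?_)
      (hF.norm.mul_const 2) (fun m => Eventually.of_forall fun x => ?_) ?_
    · have := hkc m
      exact hF.aestronglyMeasurable.norm.mul
        (Measurable.indicator (by fun_prop) (hBm m).compl).aestronglyMeasurable
    · rw [norm_mul, norm_norm, Real.norm_of_nonneg (h2 m x)]
      exact mul_le_mul_of_nonneg_left ((h3 m x).trans (min_le_left _ _)) (norm_nonneg _)
    · filter_upwards [hae] with x hx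
      refine Tendsto.const_mul _ ?_
      rcases hx with ⟨-, hx⟩ | ⟨-, -, hx⟩
      · exact tendsto_const_nhds.congr fun m =>
          (indicator_of_notMem (notMem_compl_iff.2 (hx m)) _).symm
      · refine squeeze_zero (fun m => h2 m x)
          (fun m => (h3 m x).trans (min_le_right _ _)) ?_
        have h4 := (hx.sub_const 1).norm
        simpa using h4
  have hlim3 : Tendsto (fun m => ∫ x in B m, F x) atTop (𝓝 (∫ x in Ioo a b ∩ E, F x)) := by
    have hm : MeasurableSet (Ioo a b ∩ E) := measurableSet_Ioo.inter hEc.measurableSet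
    rw [← integral_indicator hm]
    simp_rw [← integral_indicator (hBm _)]
    refine tendsto_integral_of_dominated_convergence (fun x => ‖F x‖)
      (fun m => (hF.indicator (hBm m)).aestronglyMeasurable) hF.norm
      (fun m => Eventually.of_forall fun x => norm_indicator_le_norm_self _ _) ?_
    filter_upwards [hae] with x hx
    refine tendsto_const_nhds.congr' ?_
    rcases hx with ⟨hxE, hx⟩ | ⟨hxE, hx, -⟩
    · exact Eventually.of_forall fun m => by
        simp only [indicator_of_mem hxE, indicator_of_mem (hx m)]
    · filter_upwards [hx] with m hm
      simp only [indicator_of_notMem hxE, indicator_of_notMem hm]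
  have hlimR := ((hlim1.norm.add_const
    (Real.exp (-M) * ∫ x in Ioo a b, (‖F x‖ + w x))).add hlim2).add
      tendsto_one_div_add_atTop_nhds_zero_nat
  rw [norm_zero, zero_add, add_zero, add_zero] at hlimR
  refine le_of_tendsto_of_tendsto' hlim3.norm hlimR fun m => ?_
  obtain ⟨Q, hQ⟩ := hkQ m
  exact (H m).norm_setIntegral_le hF hw hw0 hFw (hkc m) hQ (hexc m)

/-- One-sided Fourier decay `O(exp (-c √s))` of `F = f ψ` forces `F` to vanish on a closed set near
each point of which `log⁻ |f|` has divergent integral. -/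
theorem ae_mem_imp_eq_zero_of_fourier_decay {f F : ℝ → ℂ} (hf : AEStronglyMeasurable f)
    {w : ℝ → ℝ} (hF : Integrable F) (hw : Integrable w) (hw0 : ∀ x, 0 ≤ w x)
    (hFw : ∀ x, ‖F x‖ = ‖f x‖ * w x) {c C : ℝ} (hc : 0 < c) (hC : 0 ≤ C)
    (hFC : ∀ s : ℝ, 0 ≤ s → ‖∫ x : ℝ, F x * Complex.exp (-Complex.I * x * s)‖ ≤
      C * Real.exp (-c * Real.sqrt s)) {E : Set ℝ} (hEc : IsClosed E)
    (hE : ∀ u v, (Ioo u v ∩ E).Nonempty → ∫⁻ x in Ioo u v, negLog ‖f x‖ = ∞) :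
    ∀ᵐ x, x ∈ E → F x = 0 := by
  set W : ℝ → ℝ := fun x => ‖F x‖ + w x
  have hW : Integrable W := hF.norm.add hw
  have hFE : Integrable (E.indicator F) := hF.indicator hEc.measurableSet
  -- Differentiating the estimate on short intervals gives `|F| ≤ exp (-M) W` almost everywhere on
  -- `E`, for every `M`.
  filter_upwards [LocallyIntegrable.ae_hasDerivAt_integral hFE.locallyIntegrable,
    LocallyIntegrable.ae_hasDerivAt_integral hW.locallyIntegrable] with x hx1 hx2 hxE
  have hslope1 := (hasDerivAt_iff_tendsto_slope.1 (hx1 0)).mono_left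
    (nhdsWithin_mono (s := Ioi x) x fun y (hy : x < y) => hy.ne')
  have hslope2 := (hasDerivAt_iff_tendsto_slope.1 (hx2 0)).mono_left
    (nhdsWithin_mono (s := Ioi x) x fun y (hy : x < y) => hy.ne')
  rw [indicator_of_mem hxE] at hslope1
  have hbound (M : ℕ) : ‖F x‖ ≤ Real.exp (-M) * W x := by
    refine le_of_tendsto_of_tendsto hslope1.norm (hslope2.const_mul (Real.exp (-M))) ?_
    have hlim : Tendsto (fun y : ℝ => Real.pi⁻¹ * (2 * (M : ℝ) * (y - x))) (𝓝[>] x) (𝓝 0) := by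
      have h1 : Tendsto (fun y : ℝ => Real.pi⁻¹ * (2 * (M : ℝ) * (y - x))) (𝓝 x)
          (𝓝 (Real.pi⁻¹ * (2 * (M : ℝ) * (x - x)))) := Continuous.tendsto (by fun_prop) x
      rw [sub_self, mul_zero, mul_zero] at h1
      exact h1.mono_left nhdsWithin_le_nhds
    filter_upwards [(tendsto_order.1 hlim).2 (c ^ 2 / 4) (by positivity), self_mem_nhdsWithin]
      with y hy hxy
    have hxy' : x ≤ y := (mem_Ioi.1 hxy).le
    have h1 := norm_setIntegral_inter_le_of_small hf hF hw hw0 hFw hc hC hFC hEc hE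
      (Nat.cast_nonneg M) hxy' hy
    have h2 : (∫ t in (0 : ℝ)..y, E.indicator F t) - ∫ t in (0 : ℝ)..x, E.indicator F t =
        ∫ t in Ioo x y ∩ E, F t := by
      rw [intervalIntegral.integral_interval_sub_left hFE.intervalIntegrable
        hFE.intervalIntegrable, intervalIntegral.integral_of_le hxy',
        integral_Ioc_eq_integral_Ioo, setIntegral_indicator hEc.measurableSet]
    have h3 : (∫ t in (0 : ℝ)..y, W t) - ∫ t in (0 : ℝ)..x, W t = ∫ t in Ioo x y, W t := by
      rw [intervalIntegral.integral_interval_sub_left hW.intervalIntegrable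
        hW.intervalIntegrable, intervalIntegral.integral_of_le hxy',
        integral_Ioc_eq_integral_Ioo]
    rw [slope_def_module, slope_def_module, h2, h3, norm_smul, smul_eq_mul, Real.norm_of_nonneg
      (inv_nonneg.2 (sub_nonneg.2 hxy'))]
    calc _ ≤ (y - x)⁻¹ * (Real.exp (-M) * ∫ t in Ioo x y, W t) :=
          mul_le_mul_of_nonneg_left h1 (inv_nonneg.2 (sub_nonneg.2 hxy'))
      _ = _ := by ring
  have hlim : Tendsto (fun M : ℕ => Real.exp (-(M : ℝ)) * W x) atTop (𝓝 (0 * W x)) :=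
    (Real.tendsto_exp_neg_atTop_nhds_zero.comp tendsto_natCast_atTop_atTop).mul_const _
  rw [zero_mul] at hlim
  exact norm_le_zero_iff.1 (ge_of_tendsto' hlim hbound)

/-! ### Reduction to an integrable function with one-sided Fourier decay -/

/-- The bump function `β` translated by `s` and modulated with frequency `q`. -/
def modulatedBump {z : ℝ} (β : ContDiffBump z) (q s ζ : ℝ) : ℂ :=
  (β (ζ - s) : ℂ) * Complex.exp (Complex.I * q * (ζ - s : ℝ))

theorem modulatedBump_eq_zero {z : ℝ} (β : ContDiffBump z) (q s : ℝ) {ζ : ℝ}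
    (hζ : ζ ∉ Icc (z - β.rOut + s) (z + β.rOut + s)) : modulatedBump β q s ζ = 0 := by
  have h : β (ζ - s) = 0 := by
    refine β.zero_of_le_dist ?_
    by_contra hlt
    rw [not_le, Real.dist_eq, abs_lt] at hlt
    exact hζ ⟨by linarith, by linarith⟩
  rw [modulatedBump, h, Complex.ofReal_zero, zero_mul]

theorem hasCompactSupport_modulatedBump {z : ℝ} (β : ContDiffBump z) (q s : ℝ) :
    HasCompactSupport (modulatedBump β q s) :=
  HasCompactSupport.intro isCompact_Icc fun _ => modulatedBump_eq_zero β q s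

theorem tsupport_modulatedBump_subset {z : ℝ} (β : ContDiffBump z) (q s : ℝ) :
    tsupport (modulatedBump β q s) ⊆ Icc (z - β.rOut + s) (z + β.rOut + s) :=
  closure_minimal (fun _ hζ => by_contra fun h => hζ (modulatedBump_eq_zero β q s h)) isClosed_Icc

theorem contDiff_modulatedBump {z : ℝ} (β : ContDiffBump z) (q s : ℝ) :
    ContDiff ℝ (⊤ : ℕ∞) (modulatedBump β q s) := by
  refine ContDiff.mul ?_ ?_
  · exact Complex.ofRealCLM.contDiff.comp (β.contDiff.comp (contDiff_id.sub contDiff_const))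
  · refine ContDiff.cexp (contDiff_const.mul ?_)
    exact Complex.ofRealCLM.contDiff.comp (contDiff_id.sub contDiff_const)

theorem norm_modulatedBump_le_one {z : ℝ} (β : ContDiffBump z) (q s ζ : ℝ) :
    ‖modulatedBump β q s ζ‖ ≤ 1 := by
  rw [modulatedBump, norm_mul, norm_exp_I_mul, mul_one, Complex.norm_real,
    Real.norm_of_nonneg β.nonneg]
  exact β.le_one

/-- `modulatedBump` as a Schwartz function. -/
def modulatedBumpSchwartz {z : ℝ} (β : ContDiffBump z) (q s : ℝ) : 𝓢(ℝ, ℂ) :=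
  (hasCompactSupport_modulatedBump β q s).toSchwartzMap (contDiff_modulatedBump β q s)

theorem modulatedBumpSchwartz_apply {z : ℝ} (β : ContDiffBump z) (q s ζ : ℝ) :
    modulatedBumpSchwartz β q s ζ = modulatedBump β q s ζ := rfl

theorem schwartzFourier_modulatedBumpSchwartz {z : ℝ} (β : ContDiffBump z) (q s x : ℝ) :
    schwartzFourier (modulatedBumpSchwartz β q s) x =
      schwartzFourier (modulatedBumpSchwartz β q 0) x * Complex.exp (-Complex.I * x * s) := by
  rw [schwartzFourier_apply, schwartzFourier_apply, mul_assoc, ← integral_mul_const]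
  congr 1
  rw [← integral_add_right_eq_self _ s]
  refine integral_congr_ae (Eventually.of_forall fun ζ => ?_)
  simp only [modulatedBumpSchwartz_apply, modulatedBump, add_sub_cancel_right, sub_zero]
  rw [mul_assoc _ (Complex.exp _) (Complex.exp (-Complex.I * x * s)), ← Complex.exp_add]
  congr 3
  push_cast
  ring

/-- The Fourier transform of a bump function modulated with frequency `q` does not vanish at `q`. -/
theorem schwartzFourier_modulatedBumpSchwartz_self_ne_zero {z : ℝ} (β : ContDiffBump z) (q : ℝ) :
    schwartzFourier (modulatedBumpSchwartz β q 0) q ≠ 0 := by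
  have h (ζ : ℝ) : modulatedBumpSchwartz β q 0 ζ * Complex.exp (-Complex.I * ζ * q) = (β ζ : ℂ) := by
    simp only [modulatedBumpSchwartz_apply, modulatedBump, sub_zero]
    rw [mul_assoc, ← Complex.exp_add, show Complex.I * q * ζ + -Complex.I * ζ * q = 0 by ring,
      Complex.exp_zero, mul_one]
  rw [schwartzFourier_apply]
  simp_rw [h]
  rw [integral_complex_ofReal]
  refine mul_ne_zero (Complex.ofReal_ne_zero.2 (by positivity)) (Complex.ofReal_ne_zero.2 ?_)
  exact (β.integral_pos (μ := volume)).ne'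

theorem exists_rho_le {g : ℝ → ℂ} {A c : ℝ} (hg : IntegrableOn g (Ici A)) (hc : 0 < c)
    (hdecay : rho g =O[atTop] fun ζ : ℝ => Real.exp (-c * Real.sqrt ζ)) :
    ∃ C, 0 ≤ C ∧ ∀ ζ, A ≤ ζ → rho g ζ ≤ C * Real.exp (-c * Real.sqrt ζ) := by
  obtain ⟨C, hC⟩ := hdecay.bound
  obtain ⟨ζ₀, hζ₀⟩ := eventually_atTop.1 hC
  set R : ℝ := ∫ t in Ici A, ‖g t‖
  have hR : 0 ≤ R := integral_nonneg fun _ => norm_nonneg _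
  refine ⟨max C (R * Real.exp (c * Real.sqrt ζ₀)), le_max_of_le_right (by positivity),
    fun ζ hζ => ?_⟩
  rcases le_total ζ₀ ζ with h | h
  · refine (le_abs_self _).trans ((hζ₀ ζ h).trans ?_)
    rw [Real.norm_of_nonneg (Real.exp_pos _).le]
    exact mul_le_mul_of_nonneg_right (le_max_left _ _) (Real.exp_pos _).le
  · have h1 : rho g ζ ≤ R := setIntegral_mono_set hg.norm
      (Eventually.of_forall fun _ => norm_nonneg _)
      (Eventually.of_forall fun t (ht : ζ < t) => hζ.trans ht.le)
    refine h1.trans (le_trans ?_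
      (mul_le_mul_of_nonneg_right (le_max_right C _) (Real.exp_pos _).le))
    rw [mul_assoc, ← Real.exp_add]
    refine le_mul_of_one_le_right hR (Real.one_le_exp ?_)
    nlinarith [Real.sqrt_le_sqrt h]

/-- The tail `rho` of the distributional Fourier transform of `f` bounds the classical Fourier
transform of `f ψ`, where `ψ` is the Fourier transform of a bump function supported to the right of
`A`. -/
theorem norm_integral_mul_schwartzFourier_le {f : ℝ → ℂ} {n : ℝ} (hf : TemperedGrowth f n)
    {g : ℝ → ℂ} {A : ℝ}
    (hg : IsIntegrableFunctionOn (distributionalFourier hf.toTemperedDistribution) g A)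
    {z : ℝ} (β : ContDiffBump z) (hβ : A < z - β.rOut) (q : ℝ) {s : ℝ} (hs : 0 ≤ s) :
    ‖∫ x : ℝ, schwartzFourier (modulatedBumpSchwartz β q 0) x * f x *
      Complex.exp (-Complex.I * x * s)‖ ≤ rho g (A + s) := by
  set φ := modulatedBumpSchwartz β q s
  have hz (ζ : ℝ) (hζ : ζ ≤ A + s) : φ ζ = 0 :=
    modulatedBump_eq_zero β q s fun h => by linarith [h.1]
  have h1 : ∫ x : ℝ, schwartzFourier (modulatedBumpSchwartz β q 0) x * f x *
      Complex.exp (-Complex.I * x * s) = ∫ ζ in Ici A, φ ζ * g ζ := by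
    rw [← hg.apply_eq φ (hasCompactSupport_modulatedBump β q s) fun ζ hζ => ?_,
      distributionalFourier_apply, hf.toTemperedDistribution_apply]
    · refine integral_congr_ae (Eventually.of_forall fun x => ?_)
      simp only [φ]
      rw [schwartzFourier_modulatedBumpSchwartz β q s x]
      ring
    · have := (tsupport_modulatedBump_subset β q s hζ).1
      exact mem_Ioi.2 (by linarith)
  have hsub : Ioi (A + s) ⊆ Ici A := fun ζ (hζ : A + s < ζ) => mem_Ici.2 (by linarith)
  have h2 : ∫ ζ in Ici A, φ ζ * g ζ = ∫ ζ in Ioi (A + s), φ ζ * g ζ := by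
    refine setIntegral_eq_of_subset_of_forall_sdiff_eq_zero measurableSet_Ici hsub fun ζ hζ => ?_
    rw [hz ζ (not_lt.1 hζ.2), zero_mul]
  rw [h1, h2, rho]
  refine norm_integral_le_of_norm_le (hg.integrableOn.mono_set hsub).norm
    (Eventually.of_forall fun ζ => ?_)
  rw [norm_mul]
  exact mul_le_of_le_one_left (norm_nonneg _) (norm_modulatedBump_le_one β q s ζ)

theorem TemperedGrowth.integrableOn_Ioo {f : ℝ → ℂ} {n : ℝ} (hf : TemperedGrowth f n) (u v : ℝ) :
    IntegrableOn f (Ioo u v) := by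
  have hpos (x : ℝ) : 0 < 1 + |x| := by positivity
  have h1 : IntegrableOn (fun x : ℝ => ‖f x‖ / (1 + |x|) ^ n * (1 + |x|) ^ n) (Icc u v) :=
    hf.integrable.integrableOn.mul_continuousOn
      (Continuous.continuousOn (Continuous.rpow_const (by fun_prop) fun x => Or.inl (hpos x).ne'))
      isCompact_Icc
  refine ((h1.mono_set Ioo_subset_Icc_self).congr_fun (fun x _ => ?_) measurableSet_Ioo).mono'
    (g := fun x => ‖f x‖) hf.aestronglyMeasurable.restrict
    (Eventually.of_forall fun x => le_rfl)
  exact div_mul_cancel₀ _ (Real.rpow_pos_of_pos (hpos x) n).ne'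

end

end Clumping

open Clumping in
theorem mainTheorem3 (f : ℝ → ℂ) (n : ℝ) (hn : 0 < n) (hf : Clumping.TemperedGrowth f n)
    (fhat : ℝ → ℂ) (A : ℝ)
    (hfhat : Clumping.IsIntegrableFunctionOn
      (Clumping.distributionalFourier hf.toTemperedDistribution) fhat A)
    (c : ℝ) (hc : 0 < c)
    (hdecay : Clumping.rho fhat =O[atTop] fun ζ : ℝ => Real.exp (-c * Real.sqrt ζ)) :
    ∃ U : Set ℝ, IsOpen U ∧ (∀ᵐ x : ℝ, x ∉ U → f x = 0) ∧
      ∀ x ∈ U, ∃ a b : ℝ, x ∈ Set.Ioo a b ∧ Clumping.LogIntegrableOn f (Set.Ioo a b) := by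
  set U : Set ℝ := ⋃ p : {p : ℝ × ℝ // LogIntegrableOn f (Ioo p.1 p.2)}, Ioo p.1.1 p.1.2
  have hU : IsOpen U := isOpen_iUnion fun _ => isOpen_Ioo
  have hE (u v : ℝ) (huv : (Ioo u v ∩ Uᶜ).Nonempty) :
      ∫⁻ x in Ioo u v, negLog ‖f x‖ = ∞ := by
    by_contra h
    obtain ⟨x, hx, hxU⟩ := huv
    exact hxU (mem_iUnion.2 ⟨⟨(u, v), logIntegrableOn_of_lintegral_negLog_ne_top
      (hf.integrableOn_Ioo u v) h⟩, hx⟩)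
  refine ⟨U, hU, ?_, fun x hx => ?_⟩
  swap
  · obtain ⟨⟨p, hp⟩, hxp⟩ := mem_iUnion.1 hx
    exact ⟨p.1, p.2, hxp, hp⟩
  -- The threshold is raised to `max A 0`, so that `√(A' + s) ≥ √s` for `s ≥ 0`.
  set A' : ℝ := max A 0
  have hg' : IsIntegrableFunctionOn (distributionalFourier hf.toTemperedDistribution) fhat A' := by
    refine ⟨hfhat.integrableOn.mono_set (Ici_subset_Ici.2 (le_max_left _ _)), fun φ hφ hsupp => ?_⟩
    rw [hfhat.apply_eq φ hφ (hsupp.trans (Ioi_subset_Ioi (le_max_left _ _)))]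
    refine setIntegral_eq_of_subset_of_forall_sdiff_eq_zero measurableSet_Ici
      (Ici_subset_Ici.2 (le_max_left _ _)) fun ζ hζ => ?_
    rw [image_eq_zero_of_notMem_tsupport fun h => hζ.2 (mem_Ici.2 (mem_Ioi.1 (hsupp h)).le),
      zero_mul]
  obtain ⟨C, hC, hrho⟩ := exists_rho_le hg'.integrableOn hc hdecay
  let β : ContDiffBump (A' + 2) := ⟨1 / 2, 1, by norm_num, by norm_num⟩
  have hβ : A' < A' + 2 - β.rOut := by
    change A' < A' + 2 - 1
    linarith
  have hzero (q : ℝ) : ∀ᵐ x, x ∈ Uᶜ →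
      schwartzFourier (modulatedBumpSchwartz β q 0) x * f x = 0 := by
    set ψ := schwartzFourier (modulatedBumpSchwartz β q 0)
    obtain ⟨_, _, -, hint⟩ := hf.exists_bound
    refine ae_mem_imp_eq_zero_of_fourier_decay hf.aestronglyMeasurable (hint ψ).1
      ψ.integrable.norm (fun x => norm_nonneg _) (fun x => ?_) hc hC (fun s hs => ?_)
      hU.isClosed_compl hE
    · rw [norm_mul, mul_comm]
    · refine (norm_integral_mul_schwartzFourier_le hf hg' β hβ q hs).trans
        ((hrho (A' + s) (by linarith)).trans (mul_le_mul_of_nonneg_left ?_ hC))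
      have h1 : Real.sqrt s ≤ Real.sqrt (A' + s) :=
        Real.sqrt_le_sqrt (by linarith [le_max_right A 0])
      exact Real.exp_le_exp.2 (by nlinarith)
  -- Near each point `q` one of the multipliers `ψ` has no zeros.
  refine measure_null_of_locally_null _ fun q _ => ?_
  have hne : ∀ᶠ x in 𝓝 q, schwartzFourier (modulatedBumpSchwartz β q 0) x ≠ 0 :=
    (schwartzFourier (modulatedBumpSchwartz β q 0)).continuous.continuousAt.eventually_ne
      (schwartzFourier_modulatedBumpSchwartz_self_ne_zero β q)
  refine ⟨_, inter_mem_nhdsWithin _ hne, measure_mono_null (fun x hx => ?_) (ae_iff.1 (hzero q))⟩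
  obtain ⟨hx1, hx2⟩ := hx
  intro h
  refine hx1 fun hxU => ?_
  exact (mul_eq_zero.1 (h hxU)).resolve_left hx2
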